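/- Model. A bidirectional radio network with $n$ nodes is a connected undirected simple graph on $n$ nodes, whose nodes carry pairwise distinct positive integer labels. Computation proceeds in synchronous rounds, and all nodes start together in round $0$. In each round every node transmits a message of arbitrary size, or acts as a receiver, or is inactive. A node receives a message in a round if and only if it acts as a receiver in that round and exactly one of its neighbours transmits; it then receives this message together with the label of the transmitting neighbour. Otherwise it receives nothing; in particular, a collision cannot be distinguished from silence. A deterministic protocol is one rule, the same for all nodes, that determines the action of a node in each round from $n$, its own label, its own initial message (rumor), and what it received in the previous rounds; nodes know nothing else about the network. The rumors may be arbitrary. The protocol completes gossiping on a network in $t$ rounds if, for every assignment of rumors to the nodes, after $t$ rounds every node can determine, from $n$, its own label, its own rumor and what it has received, the set of all pairs (label of $y$, rumor of $y$), $y$ ranging over the nodes of the network. Theorem. For every natural number $c$ there is a function $T:\mathbb N\to\mathbb N$ with $$T(n)=O\bigl(n\,(\lg n)^2\,\lg\lg n\bigr)\qquad (n\to\infty),\qquad \lg=\log_2,$$ such that, for every set $R$ of possible rumors, there is a deterministic protocol that, for every $n\ge 1$, completes gossiping in $T(n)$ rounds on every bidirectional radio network of $n$ nodes with labels in $\{1,\dots,n^c\}$.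 -/

import Mathlib

open Filter Asymptotics

universe u v

namespace RadioNetwork

/-- What a node does in one round: transmit a message, listen, or be inactive. -/
inductive Action (M : Type u) : Type u
  | transmit (m : M) : Action M
  | receive : Action M
  | idle : Action M

/-- What a node has heard so far: one entry per elapsed round, the most recent round first.
An entry is `none` if nothing was received in that round, and `some (ℓ, m)` if the message `m`
was received from the node with label `ℓ`.  The length of the list is the number of the current
round (all nodes start together in round `0`). -/
abbrev History (M : Type u) : Type u := List (Option (ℕ × M))

/-- A deterministic protocol for nodes that hold rumors from `R`.  Every node runs the same
protocol.  Messages may be arbitrarily large: the protocol chooses its own type of messages.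
The arguments of `act` and `output` are the number `n` of nodes of the network, the node's own
label, its own rumor, and what it has heard so far; nothing else about the network is available.
`output` is the collection of (label, rumor) pairs that the node reports. -/
structure Protocol (R : Type u) where
  Msg : Type u
  act : (n : ℕ) → (label : ℕ) → R → History Msg → Action Msg
  output : (n : ℕ) → (label : ℕ) → R → History Msg → Set (ℕ × R)

/-- Node `x` receives the message `m` from its neighbour `y` when the nodes act according to `a`:
`x` listens, `y` transmits `m`, and no other neighbour of `x` transmits. -/
def Hears {V : Type v} {M : Type u} (G : SimpleGraph V) (a : V → Action M)
    (x y : V) (m : M) : Prop :=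
  a x = Action.receive ∧ G.Adj x y ∧ a y = Action.transmit m ∧
    ∀ z : V, G.Adj x z → (∃ k : M, a z = Action.transmit k) → z = y

open Classical in
/-- The outcome of a round at node `x`: the (authenticated) message that `x` receives, if any.
A collision of two or more transmissions is not distinguished from silence. -/
noncomputable def reception {V : Type v} {M : Type u} (G : SimpleGraph V) (label : V → ℕ)
    (a : V → Action M) (x : V) : Option (ℕ × M) :=
  if h : ∃ p : V × M, Hears G a x p.1 p.2 then some (label h.choose.1, h.choose.2) else none

theorem reception_eq_some {V : Type v} {M : Type u} {G : SimpleGraph V} (label : V → ℕ)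
    {a : V → Action M} {x y : V} {m : M} (h : Hears G a x y m) :
    reception G label a x = some (label y, m) := by
  have hex : ∃ p : V × M, Hears G a x p.1 p.2 := ⟨(y, m), h⟩
  obtain ⟨-, hadj, htr, -⟩ := hex.choose_spec
  have hy : hex.choose.1 = y := h.2.2.2 _ hadj ⟨_, htr⟩
  have hm : hex.choose.2 = m := by
    rw [hy, h.2.2.1] at htr
    exact (Action.transmit.inj htr).symm
  rw [reception, dif_pos hex, hy, hm]

theorem reception_eq_none {V : Type v} {M : Type u} {G : SimpleGraph V} (label : V → ℕ)
    {a : V → Action M} {x : V} (h : ∀ y m, ¬ Hears G a x y m) :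
    reception G label a x = none := by
  rw [reception, dif_neg]
  rintro ⟨p, hp⟩
  exact h _ _ hp

/-- What each node has heard during the first `t` rounds of the execution of `π` on the
network `G` with the given labels and initial rumors. -/
noncomputable def Protocol.history {R : Type u} (π : Protocol R) {V : Type v} [Fintype V]
    (G : SimpleGraph V) (label : V → ℕ) (rumor : V → R) : ℕ → V → History π.Msg
  | 0, _ => []
  | t + 1, x =>
      reception G label
          (fun y => π.act (Fintype.card V) (label y) (rumor y) (history π G label rumor t y)) x ::
        history π G label rumor t x

/-- Whatever the initial rumors are, after `t` rounds every node knows the rumor of every node. -/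
def Protocol.CompletesGossiping {R : Type u} (π : Protocol R) {V : Type v} [Fintype V]
    (G : SimpleGraph V) (label : V → ℕ) (t : ℕ) : Prop :=
  ∀ (rumor : V → R) (x : V),
    π.output (Fintype.card V) (label x) (rumor x) (π.history G label rumor t x) =
      Set.range fun y : V => (label y, rumor y)

end RadioNetwork

/-! The core is a wake-up schedule: fixed transmitter sets such that any `k` nodes of a set, waking
at arbitrary times, have a round with a single transmitter within `4 A k` rounds of the first
wake-up. A node awake for `a` rounds gets weight about `A / a`. Once a family is cropped to a dense
window, the awake weight is at least `1/4`, and by the harmonic sum it is `O(log n)` in half of the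
rounds. Only `O(log log n)` dyadic transmission rates are then relevant, and a fixed set isolates a
node in a `1 / O(log log n)` fraction of all families in a good position. The method of conditional
expectations handles all families at once, with `A = O(log n * log log n)`
(`exists_isWakeupSchedule`).

Flooding with such a schedule costs `B = 4 A n` rounds (`wakeTime_le`): along a walk to the target,
each node is charged only to the last walk vertex it neighbours, so the costs `4 A k` add up to at
most `4 A n`. A broadcast with several sources of one common message computes a network-wide OR, so
`O(log n)` broadcasts elect the largest label by binary search (`exec_elect`).

A leader and one of its neighbours are elected, and a token collects all rumors by depth-first
search. Each move finds an unvisited neighbour by binary search with three-round tests, in which a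
known neighbour (the helper) makes silence distinguishable from collision (`exec_probeStep`). The `2
n` moves cost `O(n log n)` rounds, and a last broadcast spreads the result. The elections dominate:
`O(log n) * B`. -/

namespace RadioNetwork

/-! ### Isolating one transmitter: random selection and its derandomization -/

section Isolation

variable {X : Type*} [DecidableEq X]

/-- The probability that exactly one element of `K` is selected, if every `x` is selected
independently with probability `p x`. -/
def isoProb (K : Finset X) (p : X → ℝ) : ℝ :=
  ∑ x ∈ K, ∏ y ∈ K, if y = x then p y else 1 - p y

/-- Each product contains the factor of `z` at most once, so the probability is affine in `p z`.
This is what makes rounding one coordinate at a time possible. -/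
theorem isoProb_affine (K : Finset X) (p : X → ℝ) (z : X) :
    isoProb K p = p z * isoProb K (Function.update p z 1) +
      (1 - p z) * isoProb K (Function.update p z 0) := by
  unfold isoProb
  rw [Finset.mul_sum, Finset.mul_sum, ← Finset.sum_add_distrib]
  refine Finset.sum_congr rfl fun x _ => ?_
  by_cases hz : z ∈ K
  · rw [← Finset.mul_prod_erase K _ hz, ← Finset.mul_prod_erase K _ hz,
      ← Finset.mul_prod_erase K _ hz]
    have h : ∀ r : ℝ, ∏ y ∈ K.erase z, (if y = x then Function.update p z r y
        else 1 - Function.update p z r y) = ∏ y ∈ K.erase z, (if y = x then p y else 1 - p y) :=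
      fun r => Finset.prod_congr rfl fun y hy => by
        rw [Function.update_of_ne (Finset.ne_of_mem_erase hy)]
    rw [h, h]
    simp only [Function.update_self]
    split_ifs <;> ring
  · have h : ∀ r : ℝ, ∏ y ∈ K, (if y = x then Function.update p z r y
        else 1 - Function.update p z r y) = ∏ y ∈ K, (if y = x then p y else 1 - p y) :=
      fun r => Finset.prod_congr rfl fun y hy => by
        rw [Function.update_of_ne (show y ≠ z from fun e => hz (e ▸ hy))]
    rw [h, h]
    ring

open Classical in
theorem isoProb_le_indicator (K : Finset X) (p : X → ℝ) (hp : ∀ x ∈ K, p x = 0 ∨ p x = 1) :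
    isoProb K p ≤ if ∃! x, x ∈ K ∧ p x = 1 then 1 else 0 := by
  have hzero : ∀ x ∈ K, (¬ ∀ y ∈ K, p y = 1 ↔ y = x) →
      (∏ y ∈ K, if y = x then p y else 1 - p y) = 0 := by
    intro x _ h
    push Not at h
    obtain ⟨y, hy, h⟩ := h
    refine Finset.prod_eq_zero hy ?_
    rcases hp y hy with h0 | h1
    · have : y = x := by simpa [h0] using h
      simp [this] at h0 ⊢; exact h0
    · have : y ≠ x := by simpa [h1] using h
      simp [this, h1]
  split_ifs with hu
  · obtain ⟨x, ⟨hx, hx1⟩, hxu⟩ := hu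
    unfold isoProb
    rw [Finset.sum_eq_single_of_mem x hx]
    · refine Finset.prod_le_one ?_ ?_ <;> intro y hy <;> rcases hp y hy with h | h <;>
        split_ifs <;> simp [h]
    · intro y hy hyx
      refine hzero y hy fun h => hyx ?_
      exact ((h x hx).1 hx1).symm
  · refine (Finset.sum_eq_zero fun x hx => hzero x hx fun h => hu ⟨x, ⟨hx, (h x hx).2 rfl⟩, ?_⟩).le
    exact fun y hy => (h y hy.1).1 hy.2

theorem one_sub_sum_le_prod (K : Finset X) (p : X → ℝ) (h0 : ∀ x, 0 ≤ p x) (h1 : ∀ x, p x ≤ 1) :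
    1 - ∑ x ∈ K, p x ≤ ∏ x ∈ K, (1 - p x) := by
  induction K using Finset.induction_on with
  | empty => simp
  | insert a s ha ih =>
    rw [Finset.sum_insert ha, Finset.prod_insert ha]
    have hs : 0 ≤ ∑ x ∈ s, p x := Finset.sum_nonneg fun x _ => h0 x
    nlinarith [h0 a, h1 a, mul_le_mul_of_nonneg_left ih (sub_nonneg.2 (h1 a))]

/-- A selected element stays alone with probability at least one minus the sum of the others, hence
at least `1/2`. -/
theorem half_sum_le_isoProb (K : Finset X) (p : X → ℝ) (h0 : ∀ x, 0 ≤ p x) (h1 : ∀ x, p x ≤ 1)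
    (hs : ∑ x ∈ K, p x ≤ 1 / 2) : (∑ x ∈ K, p x) / 2 ≤ isoProb K p := by
  unfold isoProb
  rw [Finset.sum_div]
  refine Finset.sum_le_sum fun x hx => ?_
  rw [← Finset.mul_prod_erase K _ hx, if_pos rfl]
  have e : ∏ y ∈ K.erase x, (if y = x then p y else 1 - p y) = ∏ y ∈ K.erase x, (1 - p y) :=
    Finset.prod_congr rfl fun y hy => if_neg (Finset.ne_of_mem_erase hy)
  rw [e]
  have h2 := one_sub_sum_le_prod (K.erase x) p h0 h1
  have h3 : ∑ y ∈ K.erase x, p y ≤ ∑ y ∈ K, p y :=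
    Finset.sum_le_sum_of_subset_of_nonneg (Finset.erase_subset _ _) fun i _ _ => h0 i
  nlinarith [h0 x]

/-- Independent selection probabilities can be rounded to a deterministic choice. -/
theorem exists_rounding {ι : Type*} (I : Finset ι) (c : ι → ℝ) (K : ι → Finset X)
    (U : Finset X) (p : X → ℝ) (h0 : ∀ x, 0 ≤ p x) (h1 : ∀ x, p x ≤ 1) :
    ∃ p' : X → ℝ, (∀ x, 0 ≤ p' x) ∧ (∀ x, p' x ≤ 1) ∧ (∀ x ∈ U, p' x = 0 ∨ p' x = 1) ∧
      ∑ i ∈ I, c i * isoProb (K i) p ≤ ∑ i ∈ I, c i * isoProb (K i) p' := by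
  induction U using Finset.induction_on with
  | empty => exact ⟨p, h0, h1, by simp, le_rfl⟩
  | insert z s hz ih =>
    obtain ⟨p', h0', h1', hs, hle⟩ := ih
    have key : ∑ i ∈ I, c i * isoProb (K i) p' =
        p' z * ∑ i ∈ I, c i * isoProb (K i) (Function.update p' z 1) +
        (1 - p' z) * ∑ i ∈ I, c i * isoProb (K i) (Function.update p' z 0) := by
      rw [Finset.mul_sum, Finset.mul_sum, ← Finset.sum_add_distrib]
      refine Finset.sum_congr rfl fun i _ => ?_
      rw [isoProb_affine (K i) p' z]
      ring
    -- By `key` the objective is a convex combination of its values at `p' z = 0` and `p' z = 1`, so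
    -- one of these is at least as good.
    have hex : ∃ r : ℝ, (r = 0 ∨ r = 1) ∧ ∑ i ∈ I, c i * isoProb (K i) p' ≤
        ∑ i ∈ I, c i * isoProb (K i) (Function.update p' z r) := by
      by_contra hno
      push Not at hno
      have a0 := hno 0 (Or.inl rfl)
      have a1 := hno 1 (Or.inr rfl)
      rcases (h0' z).eq_or_lt with hz0 | hz0
      · rw [← hz0] at key; linarith
      · nlinarith [h1' z]
    obtain ⟨r, hr, hle'⟩ := hex
    refine ⟨Function.update p' z r, fun x => ?_, fun x => ?_, fun x hx => ?_, hle.trans hle'⟩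
    · rcases eq_or_ne x z with rfl | hxz
      · rcases hr with rfl | rfl <;> simp
      · simp [hxz, h0']
    · rcases eq_or_ne x z with rfl | hxz
      · rcases hr with rfl | rfl <;> simp
      · simp [hxz, h1']
    · rcases eq_or_ne x z with rfl | hxz
      · simpa using hr
      · simpa [hxz] using hs x (Finset.mem_of_mem_insert_of_ne hx hxz)

open Classical in
theorem exists_set_isoProb_le {ι : Type*} (I : Finset ι) (c : ι → ℝ) (hc : ∀ i, 0 ≤ c i)
    (K : ι → Finset X) (p : X → ℝ) (h0 : ∀ x, 0 ≤ p x) (h1 : ∀ x, p x ≤ 1) :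
    ∃ D : Set X, ∑ i ∈ I, c i * isoProb (K i) p ≤
      ∑ i ∈ I, c i * if ∃! x, x ∈ K i ∧ x ∈ D then 1 else 0 := by
  obtain ⟨p', -, -, h, hle⟩ := exists_rounding I c K (I.biUnion K) p h0 h1
  refine ⟨{x | p' x = 1}, hle.trans (Finset.sum_le_sum fun i hi => ?_)⟩
  refine mul_le_mul_of_nonneg_left ?_ (hc i)
  exact isoProb_le_indicator (K i) p' fun x hx => h x (Finset.mem_biUnion.2 ⟨i, hi, hx⟩)

open Classical in
/-- If all total weights lie in `[1/4, 2^m]`, one set of transmitters isolates an element of a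
`1 / (16 (m + 1))` fraction of the families. -/
theorem exists_isolating_set {ι : Type*} (I : Finset ι) (c : ι → ℝ) (hc : ∀ i, 0 ≤ c i)
    (K : ι → Finset X) (w : X → ℝ) (h0 : ∀ x, 0 ≤ w x) (h1 : ∀ x, w x ≤ 1) (m : ℕ)
    (hw : ∀ i ∈ I, 1 / 4 ≤ ∑ x ∈ K i, w x ∧ ∑ x ∈ K i, w x ≤ 2 ^ m) :
    ∃ D : Set X, ∑ i ∈ I, c i ≤
      16 * (m + 1) * ∑ i ∈ I, c i * if ∃! x, x ∈ K i ∧ x ∈ D then 1 else 0 := by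
  have hp0 : ∀ (ρ : ℕ) x, 0 ≤ w x / 2 ^ (ρ + 1) := fun ρ x => by have := h0 x; positivity
  have hp1 : ∀ (ρ : ℕ) x, w x / 2 ^ (ρ + 1) ≤ 1 := fun ρ x => by
    rw [div_le_one (by positivity)]
    exact (h1 x).trans (one_le_pow₀ (by norm_num))
  have hiso0 : ∀ (ρ : ℕ) (L : Finset X), 0 ≤ isoProb L fun x => w x / 2 ^ (ρ + 1) := fun ρ L =>
    Finset.sum_nonneg fun x _ => Finset.prod_nonneg fun y _ => by
      split_ifs
      · exact hp0 ρ y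
      · exact sub_nonneg.2 (hp1 ρ y)
  have hone : ∀ i ∈ I, 1 / 16 ≤ ∑ ρ ∈ Finset.range (m + 1),
      isoProb (K i) fun x => w x / 2 ^ (ρ + 1) := by
    intro i hi
    obtain ⟨hl, hu⟩ := hw i hi
    -- For the least such `ρ`, scaling by `2 ^ (ρ + 1)` brings the total weight into `[1/8, 1/2]`,
    -- so this one rate already isolates with probability `1/16`.
    have hex : ∃ ρ : ℕ, ∑ x ∈ K i, w x ≤ 2 ^ ρ := ⟨m, hu⟩
    set ρ := Nat.find hex
    have hρ : ∑ x ∈ K i, w x ≤ 2 ^ ρ := Nat.find_spec hex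
    have hρm : ρ ≤ m := Nat.find_min' hex hu
    have hlow : 2 ^ ρ / 4 ≤ ∑ x ∈ K i, w x := by
      rcases Nat.eq_zero_or_pos ρ with h | h
      · rw [h]; simpa using hl
      · have h' := Nat.find_min hex (m := ρ - 1) (by omega)
        push Not at h'
        have e : (2 : ℝ) ^ ρ = 2 * 2 ^ (ρ - 1) := by
          rw [← pow_succ', Nat.sub_add_cancel h]
        have : (0 : ℝ) < 2 ^ (ρ - 1) := by positivity
        rw [e]; linarith
    have hpos : (0 : ℝ) < 2 ^ ρ := by positivity
    have hsum : ∑ x ∈ K i, w x / 2 ^ (ρ + 1) = (∑ x ∈ K i, w x) / (2 * 2 ^ ρ) := by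
      rw [Finset.sum_div, pow_succ']
    have hh := half_sum_le_isoProb (K i) (fun x => w x / 2 ^ (ρ + 1)) (hp0 ρ) (hp1 ρ)
      (by rw [hsum, div_le_iff₀ (by positivity)]; linarith)
    have h8 : 1 / 8 ≤ ∑ x ∈ K i, w x / 2 ^ (ρ + 1) := by
      rw [hsum, le_div_iff₀ (by positivity)]; linarith
    have := Finset.single_le_sum (f := fun ρ : ℕ => isoProb (K i) fun x => w x / 2 ^ (ρ + 1))
      (fun ρ _ => hiso0 ρ (K i)) (Finset.mem_range.2 (Nat.lt_succ_of_le hρm))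
    linarith
  have htot : ∑ i ∈ I, c i ≤ 16 * ∑ ρ ∈ Finset.range (m + 1),
      ∑ i ∈ I, c i * isoProb (K i) fun x => w x / 2 ^ (ρ + 1) := by
    rw [Finset.sum_comm, Finset.mul_sum]
    refine Finset.sum_le_sum fun i hi => ?_
    rw [← Finset.mul_sum]
    nlinarith [hone i hi, hc i]
  choose D hD using fun ρ : ℕ =>
    exists_set_isoProb_le I c hc K (fun x => w x / 2 ^ (ρ + 1)) (hp0 ρ) (hp1 ρ)
  -- Pigeonhole: the `m + 1` rates together achieve `1/16` of the total, so one of them achieves a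
  -- `1 / (16 (m + 1))` fraction.
  by_contra! hno
  have : ∑ ρ ∈ Finset.range (m + 1), ∑ i ∈ I, c i * isoProb (K i) (fun x => w x / 2 ^ (ρ + 1)) <
      ∑ ρ ∈ Finset.range (m + 1), (∑ i ∈ I, c i) / (16 * (m + 1)) := by
    refine Finset.sum_lt_sum_of_nonempty ⟨0, by simp⟩ fun ρ _ => (hD ρ).trans_lt ?_
    rw [lt_div_iff₀ (by positivity)]
    linarith [hno (D ρ)]
  rw [Finset.sum_const, Finset.card_range, nsmul_eq_mul] at this
  push_cast at this
  have e : ((m : ℝ) + 1) * ((∑ i ∈ I, c i) / (16 * (m + 1))) = (∑ i ∈ I, c i) / 16 := by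
    field_simp
  rw [e] at this
  linarith

open Classical in
/-- Greedy choice of a sequence of transmitter sets, by the method of conditional expectations. -/
theorem exists_greedy_schedule {ι : Type*} (I : Finset ι) (c : ι → ℝ) (hc : ∀ i, 0 ≤ c i)
    (K : ι → ℕ → Finset X) (w : ℕ → X → ℝ) (h0 : ∀ t x, 0 ≤ w t x) (h1 : ∀ t x, w t x ≤ 1) (m : ℕ)
    (good : ι → ℕ → Prop)
    (hgood : ∀ i t, good i t → 1 / 4 ≤ ∑ x ∈ K i t, w t x ∧ ∑ x ∈ K i t, w t x ≤ 2 ^ m)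
    (r : ℝ) (hr0 : 0 ≤ r) (hr : r * (1 - 1 / (16 * (m + 1))) = 1) (T : ℕ) :
    ∃ M : ℕ → Set X, ∑ i ∈ I, c i * ∏ t ∈ Finset.range T,
      (if good i t then (if ∃! x, x ∈ K i t ∧ x ∈ M t then 0 else r) else 1) ≤ ∑ i ∈ I, c i := by
  induction T with
  | zero => exact ⟨fun _ => ∅, by simp⟩
  | succ T ih =>
    obtain ⟨M, hM⟩ := ih
    -- The potential drops a family once it is isolated in a good round and multiplies it by `r`
    -- after every other good round. A surviving family with many good rounds would thus become too
    -- heavy.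
    set f : Set X → ι → ℕ → ℝ := fun D i t =>
      if good i t then (if ∃! x, x ∈ K i t ∧ x ∈ D then 0 else r) else 1 with hf
    have hf0 : ∀ D i t, 0 ≤ f D i t := by
      intro D i t; simp only [hf]; split_ifs <;> simp [hr0]
    set c' : ι → ℝ := fun i => c i * ∏ t ∈ Finset.range T, f (M t) i t
    have hc' : ∀ i, 0 ≤ c' i := fun i => mul_nonneg (hc i) (Finset.prod_nonneg fun t _ => hf0 _ _ _)
    obtain ⟨D, hD⟩ := exists_isolating_set (I.filter fun i => good i T) c' hc' (fun i => K i T)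
      (w T) (h0 T) (h1 T) m fun i hi => hgood i T (Finset.mem_filter.1 hi).2
    refine ⟨Function.update M T D, ?_⟩
    have hprod : ∀ i, ∏ t ∈ Finset.range (T + 1), f (Function.update M T D t) i t =
        (∏ t ∈ Finset.range T, f (M t) i t) * f D i T := by
      intro i
      rw [Finset.prod_range_succ, Function.update_self]
      congr 1
      refine Finset.prod_congr rfl fun t ht => ?_
      rw [Function.update_of_ne (Finset.mem_range.1 ht).ne]
    change ∑ i ∈ I, c i * ∏ t ∈ Finset.range (T + 1), f (Function.update M T D t) i t ≤ _
    refine le_trans ?_ hM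
    have e1 : ∑ i ∈ I, c i * ∏ t ∈ Finset.range (T + 1), f (Function.update M T D t) i t =
        ∑ i ∈ I, c' i * f D i T := Finset.sum_congr rfl fun i _ => by
      rw [hprod, ← mul_assoc]
    rw [e1]
    change _ ≤ ∑ i ∈ I, c' i
    rw [← Finset.sum_filter_add_sum_filter_not I (fun i => good i T) (fun i => c' i * f D i T),
      ← Finset.sum_filter_add_sum_filter_not I (fun i => good i T) c']
    refine add_le_add ?_ ?_
    · set S := ∑ i ∈ I.filter (fun i => good i T), c' i
      set H := ∑ i ∈ I.filter (fun i => good i T),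
        c' i * if ∃! x, x ∈ K i T ∧ x ∈ D then (1 : ℝ) else 0
      -- At least a `1 / (16 (m + 1))` fraction of the good mass vanishes, and `r` is exactly the
      -- factor that compensates for this loss.
      have e2 : ∑ i ∈ I.filter (fun i => good i T), c' i * f D i T = r * (S - H) := by
        rw [← Finset.sum_sub_distrib, Finset.mul_sum]
        refine Finset.sum_congr rfl fun i hi => ?_
        simp only [hf, if_pos (Finset.mem_filter.1 hi).2]
        split_ifs <;> ring
      rw [e2]
      have hm : (0 : ℝ) < 16 * (m + 1) := by positivity
      have h3 : S * (1 / (16 * (m + 1))) ≤ H := by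
        rw [mul_one_div, div_le_iff₀ hm]; linarith
      have h4 : r * (S - H) ≤ r * (S * (1 - 1 / (16 * (m + 1)))) :=
        mul_le_mul_of_nonneg_left (by linarith) hr0
      calc r * (S - H) ≤ r * (S * (1 - 1 / (16 * (m + 1)))) := h4
        _ = S * (r * (1 - 1 / (16 * (m + 1)))) := by ring
        _ = S := by rw [hr, mul_one]
    · refine Finset.sum_le_sum fun i hi => ?_
      simp only [hf, if_neg (Finset.mem_filter.1 hi).2, mul_one]
      exact le_rfl

end Isolation

/-! ### Wake-up schedules from age-dependent weights -/

/-- The weight of a node that has been awake for `a` rounds. -/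
noncomputable def ageWeight (A a : ℕ) : ℝ := 1 / (1 + (a / A : ℕ))

theorem ageWeight_nonneg (A a : ℕ) : 0 ≤ ageWeight A a := by unfold ageWeight; positivity

theorem ageWeight_le_one (A a : ℕ) : ageWeight A a ≤ 1 := by
  unfold ageWeight
  rw [div_le_one (by positivity)]
  exact le_add_of_nonneg_right (Nat.cast_nonneg _)

theorem sum_ageWeight {A : ℕ} (hA : 0 < A) (H : ℕ) :
    ∑ a ∈ Finset.range (A * H), ageWeight A a =
      A * ∑ i ∈ Finset.range H, (1 : ℝ) / (1 + (i : ℕ)) := by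
  induction H with
  | zero => simp
  | succ H ih =>
    rw [Nat.mul_succ, Finset.sum_range_add, ih, Finset.sum_range_succ, mul_add]
    congr 1
    have : ∀ a ∈ Finset.range A, ageWeight A (A * H + a) = 1 / (1 + (H : ℕ)) := by
      intro a ha
      rw [ageWeight, Nat.mul_add_div hA, Nat.div_eq_of_lt (Finset.mem_range.1 ha), add_zero]
    rw [Finset.sum_congr rfl this]
    simp

/-- All ages are below `4 A |K|`, so every element has weight at least `1 / (4 |K|)`. -/
theorem quarter_le_sum_ageWeight {A : ℕ} (hA : 0 < A) (K : Finset (ℕ × ℕ)) (t₀ t : ℕ)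
    (h : ∀ x ∈ K, t₀ ≤ x.2) (ht₀ : t₀ ≤ t) (ht : t < t₀ + 4 * A * K.card) :
    1 / 4 ≤ ∑ x ∈ K, ageWeight A (t - x.2) := by
  have hK : 0 < K.card := by
    rcases Nat.eq_zero_or_pos K.card with h0 | h0
    · rw [h0] at ht; omega
    · exact h0
  have h1 : ∀ x ∈ K, 1 / (4 * (K.card : ℝ)) ≤ ageWeight A (t - x.2) := by
    intro x hx
    unfold ageWeight
    refine one_div_le_one_div_of_le (by positivity) ?_
    have h2 : (t - x.2) / A < 4 * K.card := by
      rw [Nat.div_lt_iff_lt_mul hA]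
      have := h x hx
      have e : 4 * K.card * A = 4 * A * K.card := by ring
      omega
    have h3 : 1 + (t - x.2) / A ≤ 4 * K.card := by omega
    exact_mod_cast h3
  calc (1 : ℝ) / 4 = ∑ x ∈ K, 1 / (4 * (K.card : ℝ)) := by
        rw [Finset.sum_const, nsmul_eq_mul]
        have : (K.card : ℝ) ≠ 0 := by positivity
        field_simp
    _ ≤ _ := Finset.sum_le_sum h1

theorem sum_window_ageWeight_le {A : ℕ} (K : Finset (ℕ × ℕ)) (t₀ L : ℕ)
    (h : ∀ x ∈ K, t₀ ≤ x.2) :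
    ∑ t ∈ Finset.Ico t₀ (t₀ + L), ∑ x ∈ K.filter (fun x => x.2 ≤ t), ageWeight A (t - x.2) ≤
      K.card * ∑ a ∈ Finset.range L, ageWeight A a := by
  have h1 : ∀ x ∈ K, ∑ t ∈ Finset.Ico t₀ (t₀ + L),
      (if x.2 ≤ t then ageWeight A (t - x.2) else 0) ≤ ∑ a ∈ Finset.range L, ageWeight A a := by
    intro x hx
    rw [← Finset.sum_filter]
    calc _ ≤ ∑ t ∈ Finset.Ico x.2 (t₀ + L), ageWeight A (t - x.2) := by
          refine Finset.sum_le_sum_of_subset_of_nonneg ?_ fun _ _ _ => ageWeight_nonneg _ _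
          intro t ht
          simp only [Finset.mem_filter, Finset.mem_Ico] at ht ⊢
          omega
      _ = ∑ a ∈ Finset.range (t₀ + L - x.2), ageWeight A a := by
          rw [Finset.sum_Ico_eq_sum_range]
          simp
      _ ≤ _ := by
          refine Finset.sum_le_sum_of_subset_of_nonneg ?_ fun _ _ _ => ageWeight_nonneg _ _
          have := h x hx
          exact Finset.range_mono (by omega)
  simp only [Finset.sum_filter]
  rw [Finset.sum_comm, ← nsmul_eq_mul, ← Finset.sum_const]
  exact Finset.sum_le_sum h1

-- Density gives the lower bound in every round of the window. Each element contributes at most `A`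
-- times a harmonic sum over the window, so by Markov's inequality at most half of the rounds exceed
-- `2 ^ m`.
open Classical in
theorem card_good_rounds {A : ℕ} (hA : 0 < A) (m n : ℕ)
    (hm : ∑ i ∈ Finset.range (4 * n), (1 : ℝ) / (1 + (i : ℕ)) ≤ 2 * 2 ^ m)
    (K : Finset (ℕ × ℕ)) (t₀ : ℕ) (hn : K.card ≤ n) (h : ∀ x ∈ K, t₀ ≤ x.2)
    (hK : ∀ t, t₀ ≤ t → t < t₀ + 4 * A * K.card →
      t < t₀ + 4 * A * (K.filter fun x => x.2 ≤ t).card) :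
    2 * A * K.card ≤ ((Finset.Ico t₀ (t₀ + 4 * A * K.card)).filter fun t =>
      1 / 4 ≤ ∑ x ∈ K.filter (fun x => x.2 ≤ t), ageWeight A (t - x.2) ∧
      ∑ x ∈ K.filter (fun x => x.2 ≤ t), ageWeight A (t - x.2) ≤ 2 ^ m).card := by
  set W : ℕ → ℝ := fun t => ∑ x ∈ K.filter (fun x => x.2 ≤ t), ageWeight A (t - x.2)
  set I := Finset.Ico t₀ (t₀ + 4 * A * K.card)
  have hlow : ∀ t ∈ I, 1 / 4 ≤ W t := by
    intro t ht
    obtain ⟨h1, h2⟩ := Finset.mem_Ico.1 ht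
    exact quarter_le_sum_ageWeight hA _ t₀ t (fun x hx => h x (Finset.mem_filter.1 hx).1) h1
      (hK t h1 h2)
  have hsum : ∑ t ∈ I, W t ≤ K.card * (A * (2 * 2 ^ m)) := by
    refine (sum_window_ageWeight_le K t₀ _ h).trans ?_
    have e : 4 * A * K.card = A * (4 * K.card) := by ring
    rw [e, sum_ageWeight hA]
    gcongr
    refine le_trans ?_ hm
    refine Finset.sum_le_sum_of_subset_of_nonneg (Finset.range_mono (by omega)) ?_
    intro i _ _; positivity
  have hcard : (I.filter fun t => 1 / 4 ≤ W t ∧ W t ≤ 2 ^ m).card +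
      (I.filter fun t => ¬ W t ≤ 2 ^ m).card = 4 * A * K.card := by
    have e : (I.filter fun t => 1 / 4 ≤ W t ∧ W t ≤ 2 ^ m) = I.filter fun t => W t ≤ 2 ^ m :=
      Finset.filter_congr fun t ht => ⟨fun h => h.2, fun h => ⟨hlow t ht, h⟩⟩
    rw [e, Finset.card_filter_add_card_filter_not]
    simp [I]
  have hbad : (((I.filter fun t => ¬ W t ≤ 2 ^ m).card : ℕ) : ℝ) * 2 ^ m ≤
      K.card * (A * (2 * 2 ^ m)) := by
    refine le_trans ?_ hsum
    rw [← nsmul_eq_mul, ← Finset.sum_const]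
    calc _ ≤ ∑ t ∈ I.filter (fun t => ¬ W t ≤ 2 ^ m), W t :=
          Finset.sum_le_sum fun t ht => (not_le.1 (Finset.mem_filter.1 ht).2).le
      _ ≤ _ := Finset.sum_le_sum_of_subset_of_nonneg (Finset.filter_subset _ _)
          fun t ht _ => le_trans (by norm_num) (hlow t ht)
  have hbad' : (I.filter fun t => ¬ W t ≤ 2 ^ m).card ≤ 2 * A * K.card := by
    have h2 : (0 : ℝ) < 2 ^ m := by positivity
    have : (((I.filter fun t => ¬ W t ≤ 2 ^ m).card : ℕ) : ℝ) ≤ 2 * A * K.card := by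
      refine le_of_mul_le_mul_right ?_ h2
      linarith
    exact_mod_cast this
  have e : 4 * A * K.card = 2 * A * K.card + 2 * A * K.card := by ring
  change 2 * A * K.card ≤ (I.filter fun t => 1 / 4 ≤ W t ∧ W t ≤ 2 ^ m).card
  omega

/-- A schedule for nodes that wake up at different times: a node with label `x.1` that woke up in
round `x.2` transmits in round `t` if `x ∈ M t`.  If at most `k` nodes with labels below `N` take
part, then some round among the first `4 A k` has exactly one transmitter. -/
def IsWakeupSchedule (A N B : ℕ) (M : ℕ → Set (ℕ × ℕ)) : Prop :=
  ∀ (K : Finset (ℕ × ℕ)) (t₀ : ℕ), (∀ x ∈ K, x.1 < N ∧ t₀ ≤ x.2) → (∃ x ∈ K, x.2 = t₀) →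
    t₀ + 4 * A * K.card ≤ B →
      ∃ t, t₀ ≤ t ∧ t < t₀ + 4 * A * K.card ∧ ∃! x, x ∈ K ∧ x.2 ≤ t ∧ x ∈ M t

/-- Take for `t₁` the first time at which the elapsed time catches up with `4 A` times the number of
nodes awake before it. Cropping a family to those nodes makes its window exactly full and dense
throughout, which is what `card_good_rounds` needs. -/
theorem exists_dense_window {A : ℕ} (hA : 0 < A) (K : Finset (ℕ × ℕ)) (t₀ : ℕ)
    (h0 : ∃ x ∈ K, x.2 = t₀) :
    ∃ t₁, t₀ < t₁ ∧ t₁ = t₀ + 4 * A * (K.filter fun x => x.2 < t₁).card ∧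
      ∀ t, t₀ ≤ t → t < t₁ → t < t₀ + 4 * A * (K.filter fun x => x.2 ≤ t).card := by
  set j : ℕ → ℕ := fun t => (K.filter fun x => x.2 < t).card
  have hjmono : Monotone j := fun a b hab => Finset.card_le_card fun x hx => by
    simp only [Finset.mem_filter] at hx ⊢
    exact ⟨hx.1, hx.2.trans_le hab⟩
  have hjpos : 1 ≤ j (t₀ + 1) := by
    obtain ⟨x, hx, hx0⟩ := h0
    exact Finset.card_pos.2 ⟨x, Finset.mem_filter.2 ⟨hx, by omega⟩⟩
  have hjle : ∀ t, j t ≤ K.card := fun t => Finset.card_filter_le _ _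
  have hmul : ∀ {a b : ℕ}, a ≤ b → 4 * A * a ≤ 4 * A * b := fun h => Nat.mul_le_mul_left _ h
  have hex : ∃ t, t₀ < t ∧ t₀ + 4 * A * j t ≤ t :=
    ⟨t₀ + 4 * A * K.card + 1, by omega, by
      have := hmul (hjle (t₀ + 4 * A * K.card + 1)); omega⟩
  have hspec := Nat.find_spec hex
  have hmin := fun t ht => Nat.find_min hex (m := t) ht
  set t₁ := Nat.find hex
  have hlt : ∀ t, t₀ < t → t < t₁ → t < t₀ + 4 * A * j t := by
    intro t ht ht1
    by_contra hc
    exact hmin t ht1 ⟨ht, by omega⟩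
  have hA4 : 4 * A * 1 ≤ 4 * A * j (t₀ + 1) := hmul hjpos
  have h1 : t₀ + 1 < t₁ := by
    rcases Nat.lt_or_ge (t₀ + 1) t₁ with h | h
    · exact h
    · have e : t₁ = t₀ + 1 := by omega
      have h3 := hspec.2
      rw [e] at h3
      omega
  refine ⟨t₁, hspec.1, le_antisymm ?_ hspec.2, fun t ht ht1 => ?_⟩
  · have h2 := hlt (t₁ - 1) (by omega) (by omega)
    have h3 := hmul (hjmono (Nat.sub_le t₁ 1))
    change t₁ ≤ t₀ + 4 * A * j t₁
    omega
  · have e : (K.filter fun x => x.2 ≤ t) = K.filter fun x => x.2 < t + 1 :=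
      Finset.filter_congr fun x _ => by omega
    rw [e]
    change t < t₀ + 4 * A * j (t + 1)
    rcases ht.eq_or_lt with rfl | ht
    · omega
    · have h2 := hlt t ht ht1
      have h3 := hmul (hjmono (Nat.le_succ t))
      change 4 * A * j t ≤ 4 * A * j (t + 1) at h3
      omega

open Classical in
theorem exists_isWakeupSchedule {A : ℕ} (hA : 0 < A) (m n N B : ℕ) (hN : 0 < N) (hB : B = 4 * A * n)
    (hm : ∑ i ∈ Finset.range (4 * n), (1 : ℝ) / (1 + (i : ℕ)) ≤ 2 * 2 ^ m)
    (r : ℝ) (hr : r * (1 - 1 / (16 * (m + 1))) = 1)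
    (hbig : 3 * (N : ℝ) * B ^ 2 < r ^ (2 * A)) :
    ∃ M : ℕ → Set (ℕ × ℕ), IsWakeupSchedule A N B M := by
  have hm0 : (0 : ℝ) ≤ m := Nat.cast_nonneg m
  have hδ : (1 : ℝ) / (16 * (m + 1)) ≤ 1 / 16 :=
    one_div_le_one_div_of_le (by norm_num) (by linarith)
  have hδ0 : (0 : ℝ) ≤ 1 / (16 * (m + 1)) := by positivity
  have hr1 : 1 ≤ r := by nlinarith
  set w : ℕ → ℕ × ℕ → ℝ := fun t x => ageWeight A (t - x.2)
  -- With weight `θ ^ |K|`, all subsets of the `N * B` pairs (label, wake-up round) together weigh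
  -- at most `(1 + θ) ^ (N * B) ≤ e`, although families of every size are treated at once.
  set θ : ℝ := 1 / (N * B)
  set F : ℕ × Finset (ℕ × ℕ) → ℕ → Finset (ℕ × ℕ) := fun i t => i.2.filter fun x => x.2 ≤ t
  set good : ℕ × Finset (ℕ × ℕ) → ℕ → Prop := fun i t =>
    (i.1 ≤ t ∧ t < i.1 + 4 * A * i.2.card) ∧
      1 / 4 ≤ ∑ x ∈ F i t, w t x ∧ ∑ x ∈ F i t, w t x ≤ 2 ^ m with hgood
  have hθ : 0 ≤ θ := by positivity
  obtain ⟨M, hM⟩ := exists_greedy_schedule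
    (Finset.range B ×ˢ (Finset.range N ×ˢ Finset.range B).powerset)
    (fun i => θ ^ i.2.card) (fun i => by positivity) F w
    (fun _ _ => ageWeight_nonneg _ _) (fun _ _ => ageWeight_le_one _ _) m good
    (fun i t h => h.2) r (by linarith) hr B
  refine ⟨M, fun K₁ t₀ hK₁ h0 hK₁B => ?_⟩
  obtain ⟨t₁, ht₀₁, ht₁, hdense⟩ := exists_dense_window hA K₁ t₀ h0
  set K := K₁.filter fun x => x.2 < t₁
  have hKK₁ : 4 * A * K.card ≤ 4 * A * K₁.card :=
    Nat.mul_le_mul_left _ (Finset.card_filter_le _ _)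
  have hB0 : 0 < B := by omega
  have hfilter : ∀ t, t < t₁ → (K.filter fun x => x.2 ≤ t) = K₁.filter fun x => x.2 ≤ t := by
    intro t ht
    ext x
    simp only [K, Finset.mem_filter]
    constructor
    · exact fun h => ⟨h.1.1, h.2⟩
    · exact fun h => ⟨⟨h.1, h.2.trans_lt ht⟩, h.2⟩
  suffices h : ∃ t, t₀ ≤ t ∧ t < t₁ ∧ ∃! x, x ∈ F (t₀, K) t ∧ x ∈ M t by
    obtain ⟨t, h1, h2, h3⟩ := h
    refine ⟨t, h1, by omega, ?_⟩
    simp only [F] at h3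
    rw [hfilter t h2] at h3
    simpa only [Finset.mem_filter, and_assoc] using h3
  by_contra hno
  have hKpos : 0 < K.card := by
    rcases Nat.eq_zero_or_pos K.card with h | h
    · rw [h] at ht₁; omega
    · exact h
  have hKn : K.card ≤ n := by
    have h1 : 4 * A * K.card ≤ 4 * A * n := by omega
    exact Nat.le_of_mul_le_mul_left h1 (by omega)
  have hmem : (t₀, K) ∈ Finset.range B ×ˢ (Finset.range N ×ˢ Finset.range B).powerset := by
    simp only [Finset.mem_product, Finset.mem_range, Finset.mem_powerset]
    refine ⟨by omega, fun x hx => ?_⟩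
    obtain ⟨hx1, hx2⟩ := Finset.mem_filter.1 hx
    simp only [Finset.mem_product, Finset.mem_range]
    exact ⟨(hK₁ x hx1).1, by omega⟩
  set f : ℕ × Finset (ℕ × ℕ) → ℕ → ℝ := fun i t =>
      if good i t then (if ∃! x, x ∈ F i t ∧ x ∈ M t then 0 else r) else 1 with hf
  have hf0 : ∀ i t, 0 ≤ f i t := by
    intro i t; simp only [hf]; split_ifs <;> linarith
  have hterm := Finset.single_le_sum (f := fun i : ℕ × Finset (ℕ × ℕ) =>
    θ ^ i.2.card * ∏ t ∈ Finset.range B, f i t)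
    (fun i _ => mul_nonneg (by positivity) (Finset.prod_nonneg fun t _ => hf0 i t)) hmem
  have hcount : 2 * A * K.card ≤ ((Finset.range B).filter fun t => good (t₀, K) t).card := by
    refine (card_good_rounds hA m n hm K t₀ hKn
      (fun x hx => (hK₁ x (Finset.mem_filter.1 hx).1).2) fun t h1 h2 => ?_).trans
      (Finset.card_le_card fun t ht => ?_)
    · rw [hfilter t (by omega)]
      exact hdense t h1 (by omega)
    · simp only [Finset.mem_filter, Finset.mem_Ico, Finset.mem_range] at ht ⊢
      exact ⟨by omega, ht⟩
  -- Since `K` is never isolated, each of its good rounds contributes a factor `r`.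
  have hprod : r ^ (2 * A * K.card) ≤ ∏ t ∈ Finset.range B, f (t₀, K) t := by
    have e : ∏ t ∈ Finset.range B, f (t₀, K) t =
        ∏ t ∈ Finset.range B, if good (t₀, K) t then r else 1 := by
      refine Finset.prod_congr rfl fun t _ => ?_
      simp only [hf]
      split_ifs with h1 h2
      · exact absurd ⟨t, h1.1.1, lt_of_lt_of_eq h1.1.2 ht₁.symm, h2⟩ hno
      · rfl
      · rfl
    rw [e, ← Finset.prod_filter, Finset.prod_const]
    exact pow_le_pow_right₀ hr1 hcount
  have htotal : ∑ i ∈ Finset.range B ×ˢ (Finset.range N ×ˢ Finset.range B).powerset,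
      θ ^ i.2.card ≤ 3 * B := by
    rw [Finset.sum_product]
    simp only
    rw [Finset.sum_const, Finset.card_range, nsmul_eq_mul]
    have h1 := Finset.sum_pow_mul_eq_add_pow θ 1 (Finset.range N ×ˢ Finset.range B)
    simp only [one_pow, mul_one] at h1
    rw [h1, Finset.card_product, Finset.card_range, Finset.card_range, mul_comm]
    refine mul_le_mul_of_nonneg_right ?_ (Nat.cast_nonneg _)
    calc (θ + 1) ^ (N * B) ≤ (Real.exp θ) ^ (N * B) :=
          pow_le_pow_left₀ (by linarith) (Real.add_one_le_exp θ) _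
      _ = Real.exp 1 := by
          rw [← Real.exp_nat_mul]
          congr 1
          have : ((N : ℝ) * B) ≠ 0 := by positivity
          simp only [θ]
          push_cast
          field_simp
      _ ≤ 3 := by linarith [Real.exp_one_lt_d9]
  have hM' : ∑ i ∈ Finset.range B ×ˢ (Finset.range N ×ˢ Finset.range B).powerset,
      θ ^ i.2.card * ∏ t ∈ Finset.range B, f i t ≤ 3 * B := by
    refine le_trans (le_of_eq ?_) (hM.trans htotal)
    refine Finset.sum_congr rfl fun i _ => ?_
    congr 1
    refine Finset.prod_congr rfl fun t _ => ?_
    simp only [hf]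
    congr
  have hlow : θ ^ K.card * r ^ (2 * A * K.card) ≤ 3 * B :=
    (mul_le_mul_of_nonneg_left hprod (by positivity)).trans (hterm.trans hM')
  rw [pow_mul, ← mul_pow] at hlow
  have hNB : (0 : ℝ) < N * B := by positivity
  -- This is where `hbig` enters: the gain `r ^ (2 * A)` per element beats the weight `θ` by more
  -- than the whole initial potential.
  have hbase : 3 * (B : ℝ) < θ * r ^ (2 * A) := by
    simp only [θ]
    rw [one_div, inv_mul_eq_div, lt_div_iff₀ hNB]
    calc 3 * (B : ℝ) * (N * B) = 3 * N * B ^ 2 := by ring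
      _ < _ := hbig
  have hB1 : (1 : ℝ) ≤ B := by exact_mod_cast hB0
  have := le_self_pow₀ (show 1 ≤ θ * r ^ (2 * A) by linarith) hKpos.ne'
  linarith

/-! ### Choice of parameters and running time -/

/-- The number of binary digits of `n`. -/
def bitLen (n : ℕ) : ℕ := Nat.log 2 n + 1

/-- Logarithm of the number of binary digits of `n`, up to a constant. -/
def logBitLen (n : ℕ) : ℕ := Nat.log 2 (bitLen n) + 2

/-- A number of binary digits that suffices for labels up to `n ^ c`. -/
def labelBits (c n : ℕ) : ℕ := bitLen n * c + 1

/-- The number of rounds per participating node in a wake-up schedule, divided by `4`. -/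
def stretch (c n : ℕ) : ℕ := 8 * (logBitLen n + 1) * (4 * (c + 26)) * bitLen n

/-- The number of rounds of one broadcast. -/
def blockLen (c n : ℕ) : ℕ := 4 * stretch c n * n

theorem lt_two_pow_bitLen (n : ℕ) : n < 2 ^ bitLen n := Nat.lt_pow_succ_log_self (by norm_num) n

theorem pow_lt_two_pow_labelBits (c n : ℕ) : n ^ c < 2 ^ labelBits c n := by
  rw [labelBits, pow_succ, pow_mul]
  have h := Nat.pow_le_pow_left (lt_two_pow_bitLen n).le c
  have : 0 < (2 ^ bitLen n) ^ c := by positivity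
  omega

theorem stretch_pos (c n : ℕ) : 0 < stretch c n := by
  unfold stretch bitLen; positivity

theorem sum_inv_le_two_pow_logBitLen {n : ℕ} (hn : 1 ≤ n) :
    ∑ i ∈ Finset.range (4 * n), (1 : ℝ) / (1 + (i : ℕ)) ≤ 2 * 2 ^ logBitLen n := by
  have h1 : ∑ i ∈ Finset.range (4 * n), (1 : ℝ) / (1 + (i : ℕ)) = (harmonic (4 * n) : ℝ) := by
    rw [harmonic]
    push_cast
    exact Finset.sum_congr rfl fun i _ => by rw [one_div, add_comm]
  have h2 : Real.log ((4 * n : ℕ) : ℝ) ≤ bitLen n + 2 := by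
    have h3 : ((4 * n : ℕ) : ℝ) ≤ 2 ^ (bitLen n + 2) := by
      have := lt_two_pow_bitLen n
      have h4 : 4 * n ≤ 2 ^ (bitLen n + 2) := by rw [pow_add]; omega
      exact_mod_cast h4
    have h5 : (0 : ℝ) < ((4 * n : ℕ) : ℝ) := by exact_mod_cast (by omega : 0 < 4 * n)
    refine (Real.log_le_log h5 h3).trans ?_
    rw [Real.log_pow]
    push_cast
    nlinarith [Real.log_two_lt_d9, Nat.cast_nonneg (α := ℝ) (bitLen n)]
  have h6 : bitLen n + 3 ≤ 2 * 2 ^ logBitLen n := by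
    have h7 := Nat.lt_pow_succ_log_self (b := 2) (by norm_num) (bitLen n)
    have h8 : 1 ≤ bitLen n := by unfold bitLen; omega
    rw [logBitLen, pow_succ]
    omega
  have h9 : ((bitLen n : ℝ) + 3) ≤ 2 * 2 ^ logBitLen n := by exact_mod_cast h6
  rw [h1]
  linarith [harmonic_le_one_add_log (4 * n)]

/-- The block length itself contains the factor `c + 26`, so the condition on the parameters is
self-referential. The constant `26` leaves enough room in the exponent, as `bitLen n ≥ 1`. -/
theorem three_mul_blockLen_sq_lt (c n : ℕ) :
    3 * 2 ^ labelBits c n * blockLen c n ^ 2 < 2 ^ (4 * (c + 26) * bitLen n) := by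
  set l := bitLen n with hl
  have hl1 : 1 ≤ l := by rw [hl]; unfold bitLen; omega
  have hn : n ≤ 2 ^ l := (lt_two_pow_bitLen n).le
  have hll : l ≤ 2 ^ l := (Nat.lt_two_pow_self).le
  have hm : logBitLen n + 1 ≤ 2 ^ (l + 2) := by
    have : Nat.log 2 l ≤ l := Nat.log_le_self 2 l
    rw [logBitLen, ← hl, pow_add]
    omega
  have he : c + 26 ≤ 2 ^ (c + 26) := (Nat.lt_two_pow_self).le
  have hB : blockLen c n ≤ 2 ^ (9 + (c + 26) + 3 * l) := by
    calc blockLen c n = 128 * (logBitLen n + 1) * (c + 26) * l * n := by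
          unfold blockLen stretch; rw [← hl]; ring
      _ ≤ 128 * 2 ^ (l + 2) * 2 ^ (c + 26) * 2 ^ l * 2 ^ l := by gcongr
      _ = 2 ^ (9 + (c + 26) + 3 * l) := by ring
  calc 3 * 2 ^ labelBits c n * blockLen c n ^ 2
      ≤ 3 * 2 ^ (l * c + 1) * (2 ^ (9 + (c + 26) + 3 * l)) ^ 2 := by
        unfold labelBits; rw [← hl]; gcongr
    _ = 3 * 2 ^ (l * c + 1 + 18 + 2 * (c + 26) + 6 * l) := by ring
    _ < 4 * 2 ^ (l * c + 1 + 18 + 2 * (c + 26) + 6 * l) := by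
        have : 0 < 2 ^ (l * c + 1 + 18 + 2 * (c + 26) + 6 * l) := by positivity
        omega
    _ = 2 ^ (l * c + 21 + 2 * (c + 26) + 6 * l) := by ring
    _ ≤ 2 ^ (4 * (c + 26) * l) := by
        refine Nat.pow_le_pow_right (by norm_num) ?_
        nlinarith

theorem exists_schedule (c : ℕ) {n : ℕ} (hn : 1 ≤ n) :
    ∃ M, IsWakeupSchedule (stretch c n) (2 ^ labelBits c n) (blockLen c n) M := by
  set m := logBitLen n with hm
  set δ : ℝ := 1 / (16 * (m + 1)) with hδ
  have hm0 : (0 : ℝ) ≤ m := Nat.cast_nonneg m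
  have hδ1 : δ ≤ 1 / 16 := one_div_le_one_div_of_le (by norm_num) (by linarith)
  have hpos : 0 < 1 - δ := by linarith
  refine exists_isWakeupSchedule (stretch_pos c n) m n _ _ (by positivity) rfl
    (sum_inv_le_two_pow_logBitLen hn) (1 - δ)⁻¹ (inv_mul_cancel₀ hpos.ne') ?_
  have h1 : Real.exp δ ≤ (1 - δ)⁻¹ := by
    rw [le_inv_comm₀ (Real.exp_pos _) hpos, ← Real.exp_neg]
    linarith [Real.add_one_le_exp (-δ)]
  -- `stretch` is designed for this identity: `(1 - δ)⁻¹ ≥ exp δ` then turns the `2 * stretch c n`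
  -- good rounds per node into the required power.
  have h2 : ((2 * stretch c n : ℕ) : ℝ) * δ = ((4 * (c + 26) * bitLen n : ℕ) : ℝ) := by
    rw [hδ, stretch, ← hm]
    push_cast
    field_simp
    ring
  have h3 : (2 : ℝ) ≤ Real.exp 1 := by linarith [Real.exp_one_gt_d9]
  calc 3 * ((2 ^ labelBits c n : ℕ) : ℝ) * (blockLen c n : ℝ) ^ 2
      < 2 ^ (4 * (c + 26) * bitLen n) := by exact_mod_cast three_mul_blockLen_sq_lt c n
    _ ≤ Real.exp 1 ^ (4 * (c + 26) * bitLen n) := pow_le_pow_left₀ (by norm_num) h3 _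
    _ = Real.exp δ ^ (2 * stretch c n) := by
        rw [← Real.exp_nat_mul, ← Real.exp_nat_mul, h2, mul_one]
    _ ≤ _ := pow_le_pow_left₀ (Real.exp_pos _).le h1 _

/-- The number of rounds of the gossiping protocol. -/
def gossipTime (c n : ℕ) : ℕ :=
  labelBits c n * blockLen c n + 1 + labelBits c n * blockLen c n +
    2 * n * (labelBits c n * 3 + 1) + blockLen c n

theorem gossipTime_isBigO (c : ℕ) : (fun n : ℕ => (gossipTime c n : ℝ)) =O[atTop]
    fun n : ℕ => (n : ℝ) * Real.logb 2 n ^ 2 * Real.logb 2 (Real.logb 2 n) := by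
  refine IsBigO.of_bound ((240 * (c + 1) * (128 * (c + 26)) : ℕ) : ℝ) ?_
  filter_upwards [eventually_ge_atTop 4] with n hn
  have hn0 : (0 : ℝ) < n := by exact_mod_cast (by omega : 0 < n)
  have hb0 : (1 : ℝ) ≤ bitLen n := by exact_mod_cast (by unfold bitLen; omega : 1 ≤ bitLen n)
  have hx : (2 : ℝ) ≤ Real.logb 2 n := by
    rw [Real.le_logb_iff_rpow_le (by norm_num) hn0]
    norm_num
    exact_mod_cast hn
  -- This is the reason for `n ≥ 4`: additive constants can now be absorbed into the iterated
  -- logarithm.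
  have hy : (1 : ℝ) ≤ Real.logb 2 (Real.logb 2 n) := by
    rw [Real.le_logb_iff_rpow_le (by norm_num) (by linarith)]
    simpa using hx
  have hl : (bitLen n : ℝ) ≤ 2 * Real.logb 2 n := by
    have h := Real.natLog_le_logb n 2
    unfold bitLen
    push_cast at h ⊢
    linarith
  have hm : ((logBitLen n : ℝ) + 1) ≤ 5 * Real.logb 2 (Real.logb 2 n) := by
    have h := Real.natLog_le_logb (bitLen n) 2
    have h2 : Real.logb 2 (bitLen n) ≤ Real.logb 2 (2 * Real.logb 2 n) :=
      Real.logb_le_logb_of_le (by norm_num) (by linarith) hl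
    rw [Real.logb_mul (by norm_num) (by linarith), Real.logb_self_eq_one (by norm_num)] at h2
    unfold logBitLen
    push_cast at h ⊢
    linarith
  set x := Real.logb 2 n
  set y := Real.logb 2 x
  set l := bitLen n
  set q := logBitLen n
  have hl1 : 1 ≤ l := by exact_mod_cast hb0
  have h1 : gossipTime c n ≤ 12 * (c + 1) * (128 * (c + 26)) * (n * l ^ 2 * (q + 1)) := by
    have hb : labelBits c n ≤ (c + 1) * l := by unfold labelBits; change l * c + 1 ≤ _; nlinarith
    have hB : blockLen c n = 128 * (c + 26) * (n * l * (q + 1)) := by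
      unfold blockLen stretch; change 4 * (8 * (q + 1) * (4 * (c + 26)) * l) * n = _; ring
    set E := 128 * (c + 26)
    have hE : 1 ≤ E := by simp only [E]; omega
    set Z := (c + 1) * E * (n * l ^ 2 * (q + 1)) with hZ
    have hbB : labelBits c n * blockLen c n ≤ Z := by
      rw [hB]
      calc _ ≤ ((c + 1) * l) * (E * (n * l * (q + 1))) := Nat.mul_le_mul_right _ hb
        _ = Z := by rw [hZ]; ring
    have hnZ : n * ((c + 1) * l) ≤ Z := by
      calc n * ((c + 1) * l) = (c + 1) * 1 * (n * (l * 1) * 1) := by ring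
        _ ≤ (c + 1) * E * (n * (l * l) * (q + 1)) := by gcongr; omega
        _ = Z := by rw [hZ]; ring
    have hBZ : blockLen c n ≤ Z := by
      refine le_trans ?_ hbB
      exact Nat.le_mul_of_pos_left _ (by unfold labelBits; omega)
    have hnb : n * labelBits c n ≤ Z := (Nat.mul_le_mul_left _ hb).trans hnZ
    have hn1 : n ≤ n * labelBits c n := Nat.le_mul_of_pos_right _ (by unfold labelBits; omega)
    have e : gossipTime c n = 2 * (labelBits c n * blockLen c n) + 1 + 6 * (n * labelBits c n) +
      2 * n + blockLen c n := by unfold gossipTime; ring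
    have e2 : 12 * (c + 1) * E * (n * l ^ 2 * (q + 1)) = 12 * Z := by rw [hZ]; ring
    rw [e, e2]
    omega
  have h2 : (gossipTime c n : ℝ) ≤
      12 * (c + 1) * (128 * (c + 26)) * (n * (l : ℝ) ^ 2 * (q + 1)) := by exact_mod_cast h1
  have h3 : (n : ℝ) * (l : ℝ) ^ 2 * (q + 1) ≤ n * (2 * x) ^ 2 * (5 * y) := by gcongr
  have h4 : (0 : ℝ) ≤ n * x ^ 2 * y := by positivity
  rw [Real.norm_of_nonneg (Nat.cast_nonneg _), Real.norm_of_nonneg h4]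
  calc (gossipTime c n : ℝ) ≤ 12 * (c + 1) * (128 * (c + 26)) * (n * (2 * x) ^ 2 * (5 * y)) :=
        h2.trans (mul_le_mul_of_nonneg_left h3 (by positivity))
    _ = 240 * ((c + 1) * (128 * (c + 26)) * (n * x ^ 2 * y)) := by ring
    _ = _ := by push_cast; ring

/-! ### Synchronous subroutines and their composition -/

/-- A distributed subroutine of fixed duration: every node starts with a local input in `α` and
ends with a local output in `β`. -/
structure Subroutine (M : Type u) (α : Type*) (β : Type*) where
  dur : ℕ
  act : (label : ℕ) → α → History M → Action M
  out : (label : ℕ) → α → History M → β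

namespace Subroutine

variable {M : Type u} {α β γ : Type*} {V : Type v}

/-- What each node has heard during the first `t` rounds of a subroutine. -/
noncomputable def hist (P : Subroutine M α β) (G : SimpleGraph V) (label : V → ℕ) (a : V → α) :
    ℕ → V → History M
  | 0, _ => []
  | t + 1, x =>
      reception G label (fun y => P.act (label y) (a y) (hist P G label a t y)) x ::
        hist P G label a t x

@[simp] theorem length_hist (P : Subroutine M α β) (G : SimpleGraph V) (label : V → ℕ) (a : V → α)
    (t : ℕ) (x : V) : (P.hist G label a t x).length = t := by
  induction t with
  | zero => rfl
  | succ t ih => simp [hist, ih]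

/-- The outputs of a subroutine as a function of the inputs. -/
noncomputable def exec (P : Subroutine M α β) (G : SimpleGraph V) (label : V → ℕ) (a : V → α) :
    V → β := fun x => P.out (label x) (a x) (P.hist G label a P.dur x)

/-- Local computation. -/
def pure (M : Type u) (f : ℕ → α → β) : Subroutine M α β where
  dur := 0
  act _ _ _ := Action.receive
  out l a _ := f l a

@[simp] theorem exec_pure (f : ℕ → α → β) (G : SimpleGraph V) (label : V → ℕ) (a : V → α) :
    (pure M f).exec G label a = fun x => f (label x) (a x) := rfl

/-- A single round, followed by local computation. -/
def round (act : ℕ → α → Action M) (post : ℕ → α → Option (ℕ × M) → β) : Subroutine M α β where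
  dur := 1
  act l a _ := act l a
  out l a h := post l a (h.head?.join)

theorem exec_round (act : ℕ → α → Action M) (post : ℕ → α → Option (ℕ × M) → β)
    (G : SimpleGraph V) (label : V → ℕ) (a : V → α) :
    (round act post).exec G label a = fun x =>
      post (label x) (a x) (reception G label (fun y => act (label y) (a y)) x) := rfl

/-- Sequential composition. -/
def seq (P : Subroutine M α β) (Q : Subroutine M β γ) : Subroutine M α γ where
  dur := P.dur + Q.dur
  act l a h :=
    if h.length < P.dur then P.act l a h
    else Q.act l (P.out l a (h.drop (h.length - P.dur))) (h.take (h.length - P.dur))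
  out l a h := Q.out l (P.out l a (h.drop (h.length - P.dur))) (h.take (h.length - P.dur))

theorem hist_seq_of_le (P : Subroutine M α β) (Q : Subroutine M β γ) (G : SimpleGraph V)
    (label : V → ℕ) (a : V → α) {t : ℕ} (ht : t ≤ P.dur) (x : V) :
    (P.seq Q).hist G label a t x = P.hist G label a t x := by
  induction t generalizing x with
  | zero => rfl
  | succ t ih =>
    have ih' := fun y => ih (by omega) y
    simp only [hist, ih']
    congr 2
    funext y
    simp [seq, show t < P.dur by omega]

/-- Durations are fixed, so all nodes switch to `Q` in the same round. Histories list the latest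
round first: the phase of `P` is the tail, and the prefix is a history of `Q` with its own clock. -/
theorem hist_seq_add (P : Subroutine M α β) (Q : Subroutine M β γ) (G : SimpleGraph V)
    (label : V → ℕ) (a : V → α) (t : ℕ) (x : V) :
    (P.seq Q).hist G label a (P.dur + t) x =
      Q.hist G label (P.exec G label a) t x ++ P.hist G label a P.dur x := by
  induction t generalizing x with
  | zero => simp [hist, hist_seq_of_le P Q G label a le_rfl]
  | succ t ih =>
    rw [← add_assoc]
    simp only [hist, ih, List.cons_append]
    congr 2
    funext y
    have e : t + P.dur - P.dur = t := by omega
    simp only [seq, List.length_append, length_hist, e]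
    rw [if_neg (by omega), List.drop_left' (length_hist Q G label _ t y),
      List.take_left' (length_hist Q G label _ t y)]
    rfl

theorem exec_seq (P : Subroutine M α β) (Q : Subroutine M β γ) (G : SimpleGraph V)
    (label : V → ℕ) (a : V → α) :
    (P.seq Q).exec G label a = Q.exec G label (P.exec G label a) := by
  funext x
  have e : Q.dur + P.dur - P.dur = Q.dur := by omega
  change (P.seq Q).out (label x) (a x) ((P.seq Q).hist G label a (P.dur + Q.dur) x) = _
  rw [hist_seq_add]
  simp only [seq, List.length_append, length_hist, e]
  rw [List.drop_left' (length_hist Q G label _ Q.dur x),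
    List.take_left' (length_hist Q G label _ Q.dur x)]
  rfl

/-- Run `f (k - 1)`, …, `f 0`. -/
def loop (f : ℕ → Subroutine M α α) : ℕ → Subroutine M α α
  | 0 => pure M fun _ a => a
  | k + 1 => (f k).seq (loop f k)

theorem dur_loop (f : ℕ → Subroutine M α α) {d : ℕ} (hd : ∀ i, (f i).dur = d) (k : ℕ) :
    (loop f k).dur = k * d := by
  induction k with
  | zero => simp [loop, pure]
  | succ k ih => simp only [loop, seq, ih, hd]; ring

theorem exec_loop_succ (f : ℕ → Subroutine M α α) (k : ℕ) (G : SimpleGraph V) (label : V → ℕ)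
    (a : V → α) :
    (loop f (k + 1)).exec G label a = (loop f k).exec G label ((f k).exec G label a) :=
  exec_seq _ _ _ _ _

end Subroutine

/-! ### When a node receives a message -/

section Reception

variable {M : Type u} {V : Type v} {G : SimpleGraph V} (label : V → ℕ) {a : V → Action M}

theorem reception_isSome_iff {x : V} : (reception G label a x).isSome ↔
    a x = Action.receive ∧ ∃! y, G.Adj x y ∧ ∃ m, a y = Action.transmit m := by
  constructor
  · intro h
    by_contra hno
    rw [reception_eq_none] at h
    · simp at h
    · rintro y m ⟨h1, h2, h3, h4⟩
      exact hno ⟨h1, y, ⟨h2, m, h3⟩, fun z hz => h4 z hz.1 hz.2⟩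
  · rintro ⟨h1, y, ⟨h2, m, h3⟩, h4⟩
    rw [reception_eq_some label ⟨h1, h2, h3, fun z hz hz' => h4 z ⟨hz, hz'⟩⟩]
    rfl

theorem exists_of_reception_eq_some {x : V} {l : ℕ} {m : M}
    (h : reception G label a x = some (l, m)) :
    ∃ y, G.Adj x y ∧ label y = l ∧ a y = Action.transmit m := by
  have h' := (reception_isSome_iff label).1 (by rw [h]; rfl : (reception G label a x).isSome)
  obtain ⟨h1, y, ⟨h2, m', h3⟩, h4⟩ := h'
  rw [reception_eq_some label ⟨h1, h2, h3, fun z hz hz' => h4 z ⟨hz, hz'⟩⟩] at h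
  obtain ⟨rfl, rfl⟩ : label y = l ∧ m' = m := by simpa using h
  exact ⟨y, h2, rfl, h3⟩

theorem reception_of_forall_receive {x : V} (h : ∀ y, a y = Action.receive) :
    reception G label a x = none :=
  reception_eq_none label fun y m hh => by have := hh.2.2.1; rw [h y] at this; simp at this

open Classical in
/-- If `v` is the only transmitter, precisely its neighbours hear it. -/
theorem reception_of_single {v : V} {m : M} (hv : a v = Action.transmit m)
    (h : ∀ y, y ≠ v → a y = Action.receive) (x : V) :
    reception G label a x = if G.Adj v x then some (label v, m) else none := by
  split_ifs with hadj
  · refine reception_eq_some label ⟨h x hadj.ne', hadj.symm, hv, fun z _ ⟨k, hk⟩ => ?_⟩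
    by_contra hz
    rw [h z hz] at hk
    simp at hk
  · refine reception_eq_none label fun y k hh => ?_
    have hy : y = v := by
      by_contra hy
      have := hh.2.2.1
      rw [h y hy] at this
      simp at this
    exact hadj (hy ▸ hh.2.1.symm)

end Reception

/-! ### Broadcast by flooding -/

/-- Abstract analysis of a broadcast: `τ x` is the round in which `x` wakes up. -/
theorem wakeTime_le {A N B : ℕ} {M : ℕ → Set (ℕ × ℕ)} (hM : IsWakeupSchedule A N B M)
    {V : Type v} [Fintype V] {G : SimpleGraph V} (hG : G.Connected) {label : V → ℕ}
    (hinj : Function.Injective label) (hlab : ∀ x, label x < N) (hB : B = 4 * A * Fintype.card V)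
    (τ : V → ℕ)
    (hstep : ∀ t < B, ∀ x, (∃! y, G.Adj x y ∧ τ y ≤ t ∧ (label y, τ y) ∈ M t) → τ x ≤ t + 1)
    {x₀ : V} (h0 : τ x₀ = 0) (v : V) : τ v ≤ B := by
  classical
  obtain ⟨p⟩ := hG.preconnected x₀ v
  -- `E j` consists of the nodes adjacent to a walk vertex beyond position `j`. Thus `E j \ E (j +
  -- 1)` contains the nodes whose last neighbour on the walk is at position `j + 1`; these layers
  -- are disjoint even if the walk is not a shortest path.
  set E : ℕ → Finset V := fun j =>
    Finset.univ.filter fun x => ∃ i, j < i ∧ i ≤ p.length ∧ G.Adj x (p.getVert i) with hE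
  have hmemE : ∀ j x, x ∈ E j ↔ ∃ i, j < i ∧ i ≤ p.length ∧ G.Adj x (p.getVert i) := by simp [hE]
  have hEn : ∀ j, (E j).card ≤ Fintype.card V := fun j => Finset.card_le_univ _
  have claim : ∀ j ≤ p.length, τ v ≤ 4 * A * (Fintype.card V - (E j).card) ∨
      ∃ x ∈ E j, τ x ≤ 4 * A * (Fintype.card V - (E j).card) := by
    intro j
    induction j with
    | zero =>
      intro _
      rcases Nat.eq_zero_or_pos p.length with hl | hl
      · left
        rw [← SimpleGraph.Walk.eq_of_length_eq_zero hl, h0]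
        exact Nat.zero_le _
      · right
        refine ⟨x₀, (hmemE _ _).2 ⟨1, one_pos, hl, ?_⟩, by omega⟩
        have := p.adj_getVert_succ hl
        simpa using this
    | succ j ih =>
      intro hj
      have hsub : E (j + 1) ⊆ E j := fun x hx => by
        obtain ⟨i, h1, h2, h3⟩ := (hmemE _ _).1 hx
        exact (hmemE _ _).2 ⟨i, by omega, h2, h3⟩
      set T := 4 * A * (Fintype.card V - (E j).card) with hT
      set T' := 4 * A * (Fintype.card V - (E (j + 1)).card) with hT'
      set K₀ := E j \ E (j + 1)
      have hTT' : T + 4 * A * K₀.card = T' := by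
        rw [hT, hT', ← mul_add]
        congr 1
        have h1 := Finset.card_sdiff_add_card_eq_card hsub
        have h2 := hEn j
        change K₀.card + _ = _ at h1
        omega
      have hT'B : T' ≤ B := by
        rw [hB]
        exact Nat.mul_le_mul_left _ (Nat.sub_le _ _)
      by_contra hno
      push Not at hno
      obtain ⟨hno1, hno2⟩ := hno
      rcases ih (by omega) with h | ⟨x, hx, hxT⟩
      · omega
      have hxK : x ∈ K₀ := by
        refine Finset.mem_sdiff.2 ⟨hx, fun h => ?_⟩
        have := hno2 x h
        omega
      obtain ⟨z, hz, hzmin⟩ := Finset.exists_min_image K₀ τ ⟨x, hxK⟩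
      have hpair : Function.Injective fun y => (label y, τ y) := fun y y' h =>
        hinj (Prod.ext_iff.1 h).1
      have hcard : (K₀.image fun y => (label y, τ y)).card = K₀.card :=
        Finset.card_image_of_injective _ hpair
      have hzx := hzmin x hxK
      obtain ⟨t, ht0, ht1, w, ⟨hw1, hw2, hw3⟩, hwu⟩ := hM (K₀.image fun y => (label y, τ y)) (τ z)
        (by
          intro q hq
          obtain ⟨y, hy, rfl⟩ := Finset.mem_image.1 hq
          exact ⟨hlab y, hzmin y hy⟩)
        ⟨_, Finset.mem_image_of_mem _ hz, rfl⟩ (by rw [hcard]; omega)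
      rw [hcard] at ht1
      obtain ⟨y, hy, rfl⟩ := Finset.mem_image.1 hw1
      have hadj : ∀ u ∈ K₀, G.Adj (p.getVert (j + 1)) u := by
        intro u hu
        obtain ⟨h1, h2⟩ := Finset.mem_sdiff.1 hu
        obtain ⟨i, h3, h4, h5⟩ := (hmemE _ _).1 h1
        have : i = j + 1 := by
          by_contra hi
          exact h2 ((hmemE _ _).2 ⟨i, by omega, h4, h5⟩)
        exact this ▸ h5.symm
      -- Every neighbour of walk vertex `j + 1` lies in `E j`, and those in `E (j + 1)` are still
      -- asleep by `hno2`. So isolation within `K₀` is isolation among all awake neighbours.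
      have hp := hstep t (by omega) (p.getVert (j + 1)) ⟨y, ⟨hadj y hy, hw2, hw3⟩, by
        rintro u ⟨hu1, hu2, hu3⟩
        have huK : u ∈ K₀ := by
          refine Finset.mem_sdiff.2 ⟨(hmemE _ _).2 ⟨j + 1, by omega, hj, hu1.symm⟩, fun h => ?_⟩
          have := hno2 u h
          omega
        exact hpair (hwu _ ⟨Finset.mem_image_of_mem _ huK, hu2, hu3⟩)⟩
      -- The vertex just woken is either `v` or, being adjacent to the next walk vertex, a member of
      -- `E (j + 1)`; both contradict the assumption.
      rcases hj.eq_or_lt with hjl | hjl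
      · rw [hjl, SimpleGraph.Walk.getVert_length] at hp
        omega
      · have := hno2 (p.getVert (j + 1))
          ((hmemE _ _).2 ⟨j + 2, by omega, hjl, p.adj_getVert_succ hjl⟩)
        omega
  have hle : 4 * A * (Fintype.card V - (E p.length).card) ≤ B := by
    rw [hB]
    exact Nat.mul_le_mul_left _ (Nat.sub_le _ _)
  rcases claim p.length le_rfl with h | ⟨x, hx, -⟩
  · exact h.trans hle
  · obtain ⟨i, h1, h2, -⟩ := (hmemE _ _).1 hx
    omega

/-- The round in which a node woke up together with the message it is to relay. -/
def wakeState {M : Type u} (src : Option M) : History M → Option (ℕ × M)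
  | [] => src.map fun m => (0, m)
  | e :: h => (wakeState src h).or (e.map fun p => (h.length + 1, p.2))

namespace Subroutine

variable {M : Type u} {α β : Type*} {V : Type v}

open Classical in
/-- Broadcast by flooding according to a wake-up schedule: the nodes for which `src` yields a
message are the sources. -/
noncomputable def broadcast (S : ℕ → Set (ℕ × ℕ)) (B : ℕ) (src : ℕ → α → Option M)
    (post : ℕ → α → Option M → β) : Subroutine M α β where
  dur := B
  act l a h := match wakeState (src l a) h with
    | some (s, m) => if (l, s) ∈ S h.length then Action.transmit m else Action.receive
    | none => Action.receive
  out l a h := post l a ((wakeState (src l a) h).map Prod.snd)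

-- Since all sources send the same `m`, every node learns whether a source exists: the broadcast is
-- an OR over the network, and with no source nobody ever transmits.
open Classical in
theorem exec_broadcast {A N : ℕ} {S : ℕ → Set (ℕ × ℕ)} {B : ℕ} (hS : IsWakeupSchedule A N B S)
    [Fintype V] {G : SimpleGraph V} (hG : G.Connected) {label : V → ℕ}
    (hinj : Function.Injective label) (hlab : ∀ x, label x < N) (hB : B = 4 * A * Fintype.card V)
    (src : ℕ → α → Option M) (post : ℕ → α → Option M → β) (a : V → α) (m : M)
    (hm : ∀ x, ∀ k ∈ src (label x) (a x), k = m) :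
    (broadcast S B src post).exec G label a = fun x => post (label x) (a x)
      (if ∃ y, (src (label y) (a y)).isSome then some m else none) := by
  set P := broadcast S B src post
  set st : ℕ → V → Option (ℕ × M) := fun t x =>
    wakeState (src (label x) (a x)) (P.hist G label a t x) with hst
  have hst0 : ∀ x, st 0 x = (src (label x) (a x)).map fun m => (0, m) := fun x => rfl
  set ac : ℕ → V → Action M := fun t y => P.act (label y) (a y) (P.hist G label a t y) with hac
  have hst1 : ∀ t x, st (t + 1) x =
      (st t x).or ((reception G label (ac t) x).map fun p => (t + 1, p.2)) := by
    intro t x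
    simp [hst, hist, wakeState, hac]
  have hact : ∀ t x, ac t x = match st t x with
      | some (s, m) => if (label x, s) ∈ S t then Action.transmit m else Action.receive
      | none => Action.receive := by
    intro t x
    have e := P.length_hist G label a t x
    simp only [hac, hst]
    change (match wakeState (src (label x) (a x)) (P.hist G label a t x) with
      | some (s, m) => if (label x, s) ∈ S (P.hist G label a t x).length then Action.transmit m
          else Action.receive
      | none => Action.receive) = _
    rw [e]
  have hmsg : ∀ t x, ∀ q ∈ st t x, q.2 = m ∧ ∃ y, (src (label y) (a y)).isSome := by
    intro t
    induction t with
    | zero =>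
      intro x q hq
      rw [hst0] at hq
      obtain ⟨k, hk, rfl⟩ := Option.map_eq_some_iff.1 hq
      exact ⟨hm x k hk, x, by simp [hk]⟩
    | succ t ih =>
      intro x q hq
      rw [hst1] at hq
      rcases Option.or_eq_some_iff.1 hq with h | ⟨-, h⟩
      · exact ih x q h
      · obtain ⟨⟨l, k⟩, hk, rfl⟩ := Option.map_eq_some_iff.1 h
        obtain ⟨y, -, -, hy⟩ := exists_of_reception_eq_some label hk
        rw [hact] at hy
        rcases hsy : st t y with _ | ⟨s, k'⟩
        · rw [hsy] at hy; simp at hy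
        · rw [hsy] at hy
          simp only at hy
          split_ifs at hy
          obtain rfl : k' = k := by simpa using hy
          exact ih y (s, k') hsy
  have hmono : ∀ t t' x q, st t x = some q → t ≤ t' → st t' x = some q := by
    intro t t' x q hq htt'
    induction t', htt' using Nat.le_induction with
    | base => exact hq
    | succ t' _ ih => rw [hst1, ih]; rfl
  have htime : ∀ t x q, st t x = some q → q.1 ≤ t ∧ (st q.1 x).isSome := by
    intro t
    induction t with
    | zero =>
      intro x q hq
      have hq' := hq
      rw [hst0] at hq
      obtain ⟨k, hk, rfl⟩ := Option.map_eq_some_iff.1 hq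
      exact ⟨le_rfl, by simp [hq']⟩
    | succ t ih =>
      intro x q hq
      have hq' := hq
      rw [hst1] at hq
      rcases Option.or_eq_some_iff.1 hq with h | ⟨-, h⟩
      · exact ⟨(ih x q h).1.trans (Nat.le_succ t), (ih x q h).2⟩
      · obtain ⟨k, hk, rfl⟩ := Option.map_eq_some_iff.1 h
        exact ⟨le_rfl, by simp [hq']⟩
  -- The default `B + 1` marks nodes not woken within `B` rounds.
  set τ : V → ℕ := fun x => ((st B x).map Prod.fst).getD (B + 1) with hτ
  have hsome : ∀ t ≤ B, ∀ x, τ x ≤ t → ∃ k, st t x = some (τ x, k) := by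
    intro t ht x hx
    rcases hq : st B x with _ | ⟨s, k⟩
    · simp only [hτ, hq] at hx
      simp at hx; omega
    · have e : τ x = s := by simp [hτ, hq]
      obtain ⟨q', hq'⟩ := Option.isSome_iff_exists.1 (htime B x _ hq).2
      have h2 := hmono _ B x q' hq' (htime B x _ hq).1
      rw [hq] at h2
      obtain rfl : (s, k) = q' := by simpa using h2
      exact ⟨k, by rw [e]; exact hmono _ t x _ hq' (by simpa [← e] using hx)⟩
  have hle : ∀ t ≤ B, ∀ x, (st t x).isSome → τ x ≤ t := by
    intro t ht x hx
    obtain ⟨q, hq⟩ := Option.isSome_iff_exists.1 hx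
    have e : τ x = q.1 := by simp [hτ, hmono t B x q hq ht]
    rw [e]
    exact (htime t x q hq).1
  funext x
  change post (label x) (a x) ((st B x).map Prod.snd) = _
  congr 1
  split_ifs with hex
  · obtain ⟨x₀, hx₀⟩ := hex
    have h00 : τ x₀ = 0 := by
      refine Nat.le_zero.1 (hle 0 (Nat.zero_le _) x₀ ?_)
      rw [hst0]
      simpa using hx₀
    have hx := wakeTime_le hS hG hinj hlab hB τ (fun t ht x hu => by
      -- A node that is still asleep is listening, so a unique awake scheduled neighbour does wake
      -- it.
      by_cases hxt : (st t x).isSome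
      · exact (hle t ht.le x hxt).trans (Nat.le_succ t)
      · refine hle (t + 1) ht x ?_
        have hrec : (reception G label (ac t) x).isSome := by
          rw [reception_isSome_iff]
          have hiff : ∀ y, (G.Adj x y ∧ ∃ m, ac t y = Action.transmit m) ↔
              (G.Adj x y ∧ τ y ≤ t ∧ (label y, τ y) ∈ S t) := by
            intro y
            refine and_congr_right fun _ => ?_
            rw [hact]
            constructor
            · rintro ⟨m, h⟩
              rcases hq : st t y with _ | ⟨s, k⟩
              · rw [hq] at h; simp at h
              · rw [hq] at h
                simp only at h
                split_ifs at h with hS'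
                have e : τ y = s := by simp [hτ, hmono t B y _ hq ht.le]
                exact ⟨hle t ht.le y (by simp [hq]), e ▸ hS'⟩
            · rintro ⟨h1, h2⟩
              obtain ⟨k, hk⟩ := hsome t ht.le y h1
              refine ⟨k, ?_⟩
              rw [hk]
              simp only
              rw [if_pos h2]
          refine ⟨?_, (existsUnique_congr hiff).2 hu⟩
          rw [hact]
          have : st t x = none := by simpa using hxt
          rw [this]
        rw [hst1]
        have : st t x = none := by simpa using hxt
        rw [this]
        simpa using hrec) h00 x
    obtain ⟨k, hk⟩ := hsome B le_rfl x hx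
    rw [hk]
    have := (hmsg B x _ hk).1
    simpa using this
  · rcases hq : st B x with _ | q
    · rfl
    · exact absurd (hmsg B x q hq).2 hex

end Subroutine

/-! ### Leader election by binary search -/

open Classical in
/-- Binary search for the largest element of `S` by threshold tests. -/
noncomputable def searchMax (S : Set ℕ) : ℕ → ℕ → ℕ
  | 0, acc => acc
  | i + 1, acc => searchMax S i (if ∃ l ∈ S, acc + 2 ^ i ≤ l then acc + 2 ^ i else acc)

/-- The search keeps an interval `[acc, acc + 2 ^ k)` that bounds `S` from above and still contains
an element of `S`. -/
theorem searchMax_mem {S : Set ℕ} {k acc : ℕ} (h : ∃ l ∈ S, acc ≤ l)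
    (hS : ∀ l ∈ S, l < acc + 2 ^ k) : searchMax S k acc ∈ S := by
  induction k generalizing acc with
  | zero =>
    obtain ⟨l, hl, hle⟩ := h
    have := hS l hl
    rw [pow_zero] at this
    obtain rfl : l = acc := by omega
    exact hl
  | succ k ih =>
    rw [searchMax]
    rw [pow_succ] at hS
    split_ifs with hc
    · exact ih hc fun l hl => by have := hS l hl; omega
    · push Not at hc
      exact ih h hc

/-- Labels are positive, so the result `0` signals that there is no candidate. -/
theorem searchMax_zero_of_forall {S : Set ℕ} (k : ℕ) (h : ∀ l ∈ S, False) :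
    searchMax S k 0 = 0 := by
  induction k with
  | zero => rfl
  | succ k ih =>
    rw [searchMax, if_neg (fun ⟨l, hl, _⟩ => h l hl), ih]

namespace Subroutine

variable {M : Type u} {α : Type*} {V : Type v}

open Classical in
/-- One step of the election of the candidate with the largest label: is there a candidate with
label at least `acc + 2 ^ i`? -/
noncomputable def electStep (S : ℕ → Set (ℕ × ℕ)) (B : ℕ) (m : M) (cand : α → Prop) (i : ℕ) :
    Subroutine M (α × ℕ) (α × ℕ) :=
  broadcast S B (fun l s => if cand s.1 ∧ s.2 + 2 ^ i ≤ l then some m else none)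
    (fun _ s r => (s.1, if r.isSome then s.2 + 2 ^ i else s.2))

/-- Election of the candidate with the largest label among those with less than `b` digits. -/
noncomputable def elect (S : ℕ → Set (ℕ × ℕ)) (B : ℕ) (m : M) (cand : α → Prop) (b : ℕ) :
    Subroutine M (α × ℕ) (α × ℕ) :=
  loop (electStep S B m cand) b

theorem dur_elect (S : ℕ → Set (ℕ × ℕ)) (B : ℕ) (m : M) (cand : α → Prop) (b : ℕ) :
    (elect S B m cand b).dur = b * B :=
  dur_loop (electStep S B m cand) (fun _ => rfl) b

theorem exec_elect {A N : ℕ} {S : ℕ → Set (ℕ × ℕ)} {B : ℕ} (hS : IsWakeupSchedule A N B S)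
    [Fintype V] {G : SimpleGraph V} (hG : G.Connected) {label : V → ℕ}
    (hinj : Function.Injective label) (hlab : ∀ x, label x < N) (hB : B = 4 * A * Fintype.card V)
    (m : M) (cand : α → Prop) (b : ℕ) (a : V → α) (acc : ℕ) :
    (elect S B m cand b).exec G label (fun x => (a x, acc)) =
      fun x => (a x, searchMax (label '' {y | cand (a y)}) b acc) := by
  classical
  unfold elect
  induction b generalizing acc with
  | zero => rfl
  | succ b ih =>
    rw [exec_loop_succ]
    have h1 : (electStep S B m cand b).exec G label (fun x => (a x, acc)) = fun x => (a x,
        if ∃ l ∈ label '' {y | cand (a y)}, acc + 2 ^ b ≤ l then acc + 2 ^ b else acc) := by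
      rw [electStep, exec_broadcast hS hG hinj hlab hB _ _ _ m (by
        intro x k hk
        split_ifs at hk
        · exact (Option.some.inj hk).symm
        · simp at hk)]
      have hiff : (∃ y, (if cand (a y) ∧ acc + 2 ^ b ≤ label y then some m else none).isSome) ↔
          ∃ l ∈ label '' {y | cand (a y)}, acc + 2 ^ b ≤ l := by
        constructor
        · rintro ⟨y, hy⟩
          split_ifs at hy with h
          · exact ⟨_, ⟨y, h.1, rfl⟩, h.2⟩
          · simp at hy
        · rintro ⟨_, ⟨y, hy, rfl⟩, h⟩
          exact ⟨y, by rw [if_pos ⟨hy, h⟩]; rfl⟩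
      funext x
      simp only [hiff]
      split_ifs <;> simp_all
    rw [h1, ih]
    rfl

end Subroutine

/-! ### Moving the token: neighbour tests and hand-over -/

/-- The messages of the gossiping protocol. -/
structure Packet (R : Type u) : Type u where
  target : ℕ
  helper : ℕ
  stack : List ℕ
  known : Set (ℕ × R)

/-- The packet whose content does not matter. -/
def Packet.empty (R : Type u) : Packet R := ⟨0, 0, [], ∅⟩

/-- The token of the depth-first traversal: the labels of the path back to the root, the rumors
collected so far, and the label of a neighbour of the holder. -/
structure Token (R : Type u) : Type u where
  stack : List ℕ
  known : Set (ℕ × R)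
  helper : ℕ

/-- The local state during the traversal: the rumor, the token (if held), and the lower bound of
the binary search for the next node to visit. -/
abbrev TravState (R : Type u) : Type u := (R × Option (Token R)) × ℕ

open Classical in
/-- The configuration in which `v` holds the token `T`. -/
noncomputable def tokenAt {R : Type u} {V : Type v} (rumor : V → R) (v : V) (T : Token R)
    (acc : ℕ) : V → TravState R :=
  fun x => ((rumor x, if x = v then some T else none), if x = v then acc else 0)

/-- The labels of the unvisited neighbours of the token holder. -/
def unvisited {R : Type u} {V : Type v} (G : SimpleGraph V) (label : V → ℕ) (v : V)
    (T : Token R) : Set ℕ :=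
  {l | ∃ y, G.Adj v y ∧ label y = l ∧ l ∉ Prod.fst '' T.known}

theorem reception_ite_isSome_iff {M : Type u} {V : Type v} {G : SimpleGraph V} (label : V → ℕ)
    (P : V → Prop) [DecidablePred P] (m : M) (x : V) :
    (reception G label (fun y => if P y then Action.transmit m else Action.receive) x).isSome ↔
      ¬ P x ∧ ∃! y, G.Adj x y ∧ P y := by
  have h : ∀ y, (∃ k, (if P y then Action.transmit m else Action.receive) = Action.transmit k) ↔
      P y := by
    intro y
    split_ifs with hy <;> simp [hy]
  rw [reception_isSome_iff]
  simp only [h]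
  refine and_congr_left fun _ => ?_
  split_ifs with hx <;> simp [hx]

namespace Subroutine

variable {R : Type u} {V : Type v}

/-- The node with label `l` is unvisited and its label reaches the threshold of the query. -/
def Answers (l : ℕ) (q : Option (Packet R)) : Prop :=
  ∃ k ∈ q, l ∉ Prod.fst '' k.known ∧ k.target ≤ l

/-- The query of the token holder. -/
def queryAct (i : ℕ) (s : TravState R) : Action (Packet R) :=
  match s.1.2 with
  | some T => Action.transmit ⟨s.2 + 2 ^ i, T.helper, [], T.known⟩
  | none => Action.receive

open Classical in
/-- The token holder asks whether some unvisited neighbour has label at least `acc + 2 ^ i`.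
The unvisited neighbours concerned answer twice, the second time together with the helper, so
that silence is distinguished from a collision. -/
noncomputable def probeStep (R : Type u) (i : ℕ) :
    Subroutine (Packet R) (TravState R) (TravState R) :=
  (round (fun _ (s : TravState R) => queryAct i s) (fun _ s r => (s, r.map Prod.snd))).seq <|
  (round (fun l (s : TravState R × Option (Packet R)) =>
      if Answers l s.2 then Action.transmit (Packet.empty R) else Action.receive)
    (fun _ s r => (s, r.isSome))).seq <|
  round (fun l (s : (TravState R × Option (Packet R)) × Bool) =>
      if Answers l s.1.2 ∨ ∃ k ∈ s.1.2, k.helper = l then Action.transmit (Packet.empty R)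
      else Action.receive)
    (fun _ s r => (s.1.1.1,
      if s.1.1.1.2.isSome ∧ (s.2 ∨ ¬ r.isSome) then s.1.1.2 + 2 ^ i else s.1.1.2))

open Classical in
theorem exec_probeStep {G : SimpleGraph V} {label : V → ℕ} (hinj : Function.Injective label)
    (rumor : V → R) {v w : V} {T : Token R} (hw : G.Adj v w) (hwT : label w = T.helper)
    (acc i : ℕ) :
    (probeStep R i).exec G label (tokenAt rumor v T acc) = tokenAt rumor v T
      (if ∃ l ∈ unvisited G label v T, acc + 2 ^ i ≤ l then acc + 2 ^ i else acc) := by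
  set k : Packet R := ⟨acc + 2 ^ i, T.helper, [], T.known⟩ with hk
  have h1 : ∀ x, reception G label (fun y => queryAct i (tokenAt rumor v T acc y)) x =
      if G.Adj v x then some (label v, k) else none := by
    refine reception_of_single label ?_ fun y hy => ?_
    · simp [queryAct, tokenAt, hk]
    · simp [queryAct, tokenAt, hy]
  rw [probeStep, exec_seq, exec_seq, exec_round, exec_round, exec_round]
  simp only [h1]
  set Q : V → Prop := fun y => G.Adj v y ∧ label y ∉ Prod.fst '' T.known ∧ acc + 2 ^ i ≤ label y
  have hQ : ∀ y, Answers (label y) (Option.map Prod.snd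
      (if G.Adj v y then some (label v, k) else none)) ↔ Q y := by
    intro y
    by_cases hy : G.Adj v y <;> simp [Answers, Q, hy, hk]
  have hH : ∀ y, (∃ p ∈ Option.map Prod.snd (if G.Adj v y then some (label v, k) else none),
      p.helper = label y) ↔ y = w := by
    intro y
    by_cases hy : G.Adj v y
    · simp only [hy, if_true, Option.map_some, Option.mem_def, Option.some.injEq,
        exists_eq_left', hk]
      rw [← hwT]
      exact ⟨fun h => (hinj h).symm, fun h => h ▸ rfl⟩
    · simp only [hy, if_false, Option.map_none, Option.mem_def]
      constructor
      · rintro ⟨_, h, _⟩; simp at h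
      · rintro rfl; exact absurd hw hy
  simp only [hQ, hH]
  funext x
  by_cases hx : x = v
  · subst hx
    have hiff : (∃ l ∈ unvisited G label x T, acc + 2 ^ i ≤ l) ↔ ∃ y, Q y := by
      constructor
      · rintro ⟨l, ⟨y, h1, rfl, h2⟩, h3⟩; exact ⟨y, h1, h2, h3⟩
      · rintro ⟨y, h1, h2, h3⟩; exact ⟨_, ⟨y, h1, rfl, h2⟩, h3⟩
    -- With no answerer the helper `w` is heard alone in the last round. A single answerer is heard
    -- in the round before, and two or more collide in the last round too. This also covers the case
    -- that `w` itself answers.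
    have hres : ((reception G label (fun y => if Q y then Action.transmit (Packet.empty R) else
          Action.receive) x).isSome ∨
        ¬ (reception G label (fun y => if Q y ∨ y = w then Action.transmit (Packet.empty R) else
          Action.receive) x).isSome) ↔ ∃ y, Q y := by
      rw [reception_ite_isSome_iff, reception_ite_isSome_iff]
      have hQx : ¬ Q x := fun h => G.irrefl h.1
      constructor
      · rintro (⟨-, y, hy, -⟩ | h)
        · exact ⟨y, hy.2⟩
        · by_contra hno
          push Not at hno
          refine h ⟨?_, w, ⟨hw, Or.inr rfl⟩, ?_⟩
          · rintro (h | h)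
            · exact hQx h
            · exact hw.ne h
          · rintro z ⟨-, h | h⟩
            · exact absurd h (hno z)
            · exact h
      · rintro ⟨y, hy⟩
        by_contra hno
        push Not at hno
        obtain ⟨h1, -, z, hz, hzu⟩ := hno
        have hyz : y = z := hzu y ⟨hy.1, Or.inl hy⟩
        exact h1 hQx ⟨y, ⟨hy.1, hy⟩, fun u hu => by rw [hyz]; exact hzu u ⟨hu.1, Or.inl hu.2⟩⟩
    simp only [tokenAt, if_true, Option.isSome_some, true_and, hiff, hres]
  · simp [tokenAt, hx]

/-- The token holder passes the token on: to the unvisited neighbour that has been found, or back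
along the path, or nowhere if the traversal is complete. -/
def pass (R : Type u) : Subroutine (Packet R) (TravState R) (TravState R) :=
  round
    (fun l s => match s.1.2 with
      | some T => if s.2 ≠ 0 then Action.transmit ⟨s.2, 0, l :: T.stack, T.known⟩ else
          match T.stack with
          | p :: rest => Action.transmit ⟨p, 0, rest, T.known⟩
          | [] => Action.receive
      | none => Action.receive)
    (fun l s r => ((s.1.1, match s.1.2 with
      | some T => if s.2 = 0 ∧ T.stack = [] then some T else none
      | none => match r with
        | some (sender, k) =>
            if k.target = l then some ⟨k.stack, insert (l, s.1.1) k.known, sender⟩ else none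
        | none => none), 0))

/-- The alternatives in `h1` are descent and backtracking. In both the sender is a neighbour of the
new holder, so it can serve as the next helper. -/
theorem exec_pass_aux {G : SimpleGraph V} {label : V → ℕ} (hinj : Function.Injective label)
    (rumor : V → R) {v y : V} {T : Token R} (hy : G.Adj v y) (acc : ℕ) (stack : List ℕ)
    (h1 : acc ≠ 0 ∧ acc = label y ∧ stack = label v :: T.stack ∨
      acc = 0 ∧ T.stack = label y :: stack) :
    (pass R).exec G label (tokenAt rumor v T acc) =
      tokenAt rumor y ⟨stack, insert (label y, rumor y) T.known, label v⟩ 0 := by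
  classical
  set k : Packet R := ⟨label y, 0, stack, T.known⟩ with hk
  rw [pass, exec_round]
  funext x
  rw [reception_of_single label (v := v) (m := k)]
  · by_cases hx : x = v
    · subst hx
      have h2 : ¬ (acc = 0 ∧ T.stack = []) := by
        rintro ⟨h3, h4⟩
        rcases h1 with h | h
        · exact h.1 h3
        · rw [h4] at h; simp at h
      simp [tokenAt, h2, hy.ne]
    · by_cases hxy : x = y
      · subst hxy
        simp [tokenAt, hx, hy, hk]
      · have h2 : label y ≠ label x := fun h => hxy (hinj h).symm
        by_cases hadj : G.Adj v x <;> simp [tokenAt, hx, hxy, hadj, hk, h2]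
  · rcases h1 with ⟨h1, h2, h3⟩ | ⟨h1, h2⟩
    · simp [tokenAt, h1, hk, h3]
      exact h2
    · simp [tokenAt, h1, h2, hk]
  · intro z hz
    simp [tokenAt, hz]

theorem exec_pass_stay {G : SimpleGraph V} {label : V → ℕ}
    (rumor : V → R) {v : V} {T : Token R} (hT : T.stack = []) :
    (pass R).exec G label (tokenAt rumor v T 0) = tokenAt rumor v T 0 := by
  classical
  rw [pass, exec_round]
  funext x
  rw [reception_of_forall_receive]
  · by_cases hx : x = v <;> simp [tokenAt, hx, hT]
  · intro y
    by_cases hy : y = v <;> simp [tokenAt, hy, hT]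

/-- One move of the token. -/
noncomputable def move (R : Type u) (b : ℕ) : Subroutine (Packet R) (TravState R) (TravState R) :=
  (loop (probeStep R) b).seq (pass R)

theorem dur_move (R : Type u) (b : ℕ) : (move R b).dur = b * 3 + 1 := by
  change (loop (probeStep R) b).dur + 1 = _
  rw [dur_loop (d := 3) (probeStep R) (fun _ => rfl)]

theorem exec_probe {G : SimpleGraph V} {label : V → ℕ} (hinj : Function.Injective label)
    (rumor : V → R) {v w : V} {T : Token R} (hw : G.Adj v w) (hwT : label w = T.helper)
    (acc b : ℕ) :
    (loop (probeStep R) b).exec G label (tokenAt rumor v T acc) =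
      tokenAt rumor v T (searchMax (unvisited G label v T) b acc) := by
  induction b generalizing acc with
  | zero => rfl
  | succ b ih =>
    rw [exec_loop_succ, exec_probeStep hinj rumor hw hwT, ih]
    rfl

end Subroutine

/-! ### Correctness of the depth-first traversal -/

/-- The invariant of the traversal, when `v` holds the token `T`, the nodes in `vis` have been
visited, and `stk` is the path back to the root. -/
structure TravInv {R : Type u} {V : Type v} (G : SimpleGraph V) (label : V → ℕ) (rumor : V → R)
    (v : V) (T : Token R) (vis : Finset V) (stk : List V) : Prop where
  stack_eq : T.stack = stk.map label
  known_eq : T.known = (fun y => (label y, rumor y)) '' (vis : Set V)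
  helper : ∃ w, G.Adj v w ∧ label w = T.helper
  mem : v ∈ vis
  subset : ∀ y ∈ stk, y ∈ vis
  chain : List.IsChain G.Adj (v :: stk)
  closed : ∀ y ∈ vis, y ≠ v → y ∉ stk → ∀ z, G.Adj y z → z ∈ vis

namespace TravInv

variable {R : Type u} {V : Type v} {G : SimpleGraph V} {label : V → ℕ} {rumor : V → R}
  {v : V} {T : Token R} {vis : Finset V} {stk : List V}

theorem mem_unvisited (h : TravInv G label rumor v T vis stk) (hinj : Function.Injective label)
    {l : ℕ} : l ∈ unvisited G label v T ↔ ∃ y, G.Adj v y ∧ label y = l ∧ y ∉ vis := by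
  refine exists_congr fun y => and_congr_right fun _ => and_congr_right fun hl => ?_
  rw [h.known_eq, ← hl, not_iff_not]
  constructor
  · rintro ⟨_, ⟨z, hz, rfl⟩, hzy⟩
    exact hinj hzy ▸ hz
  · exact fun hy => ⟨_, ⟨y, hy, rfl⟩, rfl⟩

/-- With an empty stack, `closed` and `hv` make the visited set closed under adjacency; connectivity
does the rest. -/
theorem vis_eq_univ [Fintype V] (h : TravInv G label rumor v T vis []) (hG : G.Connected)
    (hv : ∀ y, G.Adj v y → y ∈ vis) : vis = Finset.univ := by
  have hcl : ∀ y ∈ vis, ∀ z, G.Adj y z → z ∈ vis := by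
    intro y hy z hz
    by_cases hyv : y = v
    · exact hv z (hyv ▸ hz)
    · exact h.closed y hy hyv (by simp) z hz
  refine Finset.eq_univ_of_forall fun x => ?_
  obtain ⟨p⟩ := hG.preconnected v x
  have : ∀ {a b : V}, G.Walk a b → a ∈ vis → b ∈ vis := by
    intro a b p
    induction p with
    | nil => exact id
    | cons hadj _ ih => exact fun ha => ih (hcl _ ha _ hadj)
  exact this p h.mem

/-- A move either finds that everything has been visited, or makes progress. -/
theorem exec_move (h : TravInv G label rumor v T vis stk) (hinj : Function.Injective label) {b : ℕ}
    (hlab : ∀ x, label x < 2 ^ b) (hpos : ∀ x, 1 ≤ label x) :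
    (stk = [] ∧ (∀ y, G.Adj v y → y ∈ vis) ∧
      (Subroutine.move R b).exec G label (tokenAt rumor v T 0) = tokenAt rumor v T 0) ∨
    ∃ v' T' vis' stk', TravInv G label rumor v' T' vis' stk' ∧
      2 * vis'.card + stk.length = 2 * vis.card + stk'.length + 1 ∧
      (Subroutine.move R b).exec G label (tokenAt rumor v T 0) = tokenAt rumor v' T' 0 := by
  classical
  obtain ⟨w, hw, hwT⟩ := h.helper
  have hexec : (Subroutine.move R b).exec G label (tokenAt rumor v T 0) =
      (Subroutine.pass R).exec G label
        (tokenAt rumor v T (searchMax (unvisited G label v T) b 0)) := by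
    rw [Subroutine.move, Subroutine.exec_seq, Subroutine.exec_probe hinj rumor hw hwT]
  rw [hexec]
  by_cases hne : ∃ l, l ∈ unvisited G label v T
  · right
    obtain ⟨l, hl⟩ := hne
    have hmem : searchMax (unvisited G label v T) b 0 ∈ unvisited G label v T :=
      searchMax_mem ⟨l, hl, Nat.zero_le _⟩ fun l' hl' => by
        obtain ⟨y, -, rfl, -⟩ := hl'
        simpa using hlab y
    obtain ⟨y, hvy, hy, hyvis⟩ := (h.mem_unvisited hinj).1 hmem
    refine ⟨y, ⟨label v :: T.stack, insert (label y, rumor y) T.known, label v⟩, insert y vis,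
      v :: stk, ⟨?_, ?_, ⟨v, hvy.symm, rfl⟩, Finset.mem_insert_self _ _, ?_, ?_, ?_⟩, ?_, ?_⟩
    · simp [h.stack_eq]
    · simp [h.known_eq, Set.image_insert_eq]
    · intro z hz
      rcases List.mem_cons.1 hz with rfl | hz
      · exact Finset.mem_insert_of_mem h.mem
      · exact Finset.mem_insert_of_mem (h.subset z hz)
    · exact List.isChain_cons_cons.2 ⟨hvy.symm, h.chain⟩
    · intro z hz hzy hzs u hu
      rw [List.mem_cons, not_or] at hzs
      exact Finset.mem_insert_of_mem
        (h.closed z (Finset.mem_of_mem_insert_of_ne hz hzy) hzs.1 hzs.2 u hu)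
    · rw [Finset.card_insert_of_notMem hyvis, List.length_cons]
      ring
    · rw [Subroutine.exec_pass_aux hinj rumor hvy _ (label v :: T.stack)
        (Or.inl ⟨?_, hy.symm, rfl⟩)]
      have := hpos y
      omega
  · push Not at hne
    have hall : ∀ y, G.Adj v y → y ∈ vis := by
      intro y hy
      by_contra hyv
      exact hne (label y) ((h.mem_unvisited hinj).2 ⟨y, hy, rfl, hyv⟩)
    rw [searchMax_zero_of_forall b hne]
    cases stk with
    | nil =>
      exact Or.inl ⟨rfl, hall, Subroutine.exec_pass_stay rumor (by rw [h.stack_eq]; rfl)⟩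
    | cons p stk =>
      right
      obtain ⟨hvp, hchain⟩ := List.isChain_cons_cons.1 h.chain
      have hpvis : p ∈ vis := h.subset p List.mem_cons_self
      refine ⟨p, ⟨stk.map label, insert (label p, rumor p) T.known, label v⟩, vis, stk,
        ⟨rfl, ?_, ⟨v, hvp.symm, rfl⟩, hpvis, fun y hy => h.subset y (List.mem_cons_of_mem _ hy),
          hchain, ?_⟩, ?_, ?_⟩
      · rw [h.known_eq]
        exact Set.insert_eq_of_mem ⟨p, hpvis, rfl⟩
      · intro z hz hzp hzs u hu
        -- The node `v` being left is now off the path; it may be, because all its neighbours have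
        -- been visited.
        by_cases hzv : z = v
        · exact hall u (hzv ▸ hu)
        · exact h.closed z hz hzv (by simp [hzp, hzs]) u hu
      · rw [List.length_cons]
        ring
      · exact Subroutine.exec_pass_aux hinj rumor hvp 0 (stk.map label)
          (Or.inr ⟨rfl, by rw [h.stack_eq]; rfl⟩)

/-- The potential `2 |vis| - |stk|` grows by one with every move and never exceeds `2 n`, so the
traversal must finish in time; afterwards the configuration is stationary. -/
theorem exec_loop_move [Fintype V] (h : TravInv G label rumor v T vis stk) (hG : G.Connected)
    (hinj : Function.Injective label) {b : ℕ}
    (hlab : ∀ x, label x < 2 ^ b) (hpos : ∀ x, 1 ≤ label x) (k : ℕ)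
    (hk : 2 * Fintype.card V + stk.length < 2 * vis.card + k) :
    ∃ v' T', T'.known = Set.range (fun y => (label y, rumor y)) ∧
      (Subroutine.loop (fun _ => Subroutine.move R b) k).exec G label (tokenAt rumor v T 0) =
        tokenAt rumor v' T' 0 := by
  induction k generalizing v T vis stk with
  | zero =>
    have : vis.card ≤ Fintype.card V := Finset.card_le_univ _
    omega
  | succ k ih =>
    rw [Subroutine.exec_loop_succ]
    rcases h.exec_move hinj hlab hpos with ⟨rfl, hv, he⟩ | ⟨v', T', vis', stk', h', hcard, he⟩
    · refine ⟨v, T, ?_, ?_⟩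
      · rw [h.known_eq, h.vis_eq_univ hG hv]
        simp
      · have : ∀ j, (Subroutine.loop (fun _ => Subroutine.move R b) j).exec G label
            (tokenAt rumor v T 0) = tokenAt rumor v T 0 := by
          intro j
          induction j with
          | zero => rfl
          | succ j ihj => rw [Subroutine.exec_loop_succ, he, ihj]
        rw [he, this]
    · rw [he]
      exact ih h' (by omega)

end TravInv

/-! ### The complete gossiping protocol -/

namespace Subroutine

variable {R : Type u} {V : Type v}

open Classical in
/-- Gossiping: elect a leader, elect a neighbour of the leader, collect all rumors at a token that
traverses the network from the leader, and broadcast them. -/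
noncomputable def gossip (R : Type u) (S : ℕ → Set (ℕ × ℕ)) (B b n : ℕ) :
    Subroutine (Packet R) R (Set (ℕ × R)) :=
  (pure _ fun _ r => (r, 0)).seq <|
  (elect S B (Packet.empty R) (fun _ => True) b).seq <|
  (round (fun l (s : R × ℕ) =>
      if l = s.2 then Action.transmit (Packet.empty R) else Action.receive)
    (fun _ s r => ((s, r.isSome), 0))).seq <|
  (elect S B (Packet.empty R) (fun s => s.2 = true) b).seq <|
  (pure _ fun l s =>
    ((s.1.1.1, if l = s.1.1.2 then some ⟨[], {(l, s.1.1.1)}, s.2⟩ else none), 0)).seq <|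
  (loop (fun _ => move R b) (2 * n)).seq <|
  broadcast S B (fun _ (s : TravState R) => s.1.2.map fun T => ⟨0, 0, [], T.known⟩)
    (fun _ _ r => (r.map Packet.known).getD ∅)

theorem dur_gossip (R : Type u) (S : ℕ → Set (ℕ × ℕ)) (c n : ℕ) :
    (gossip R S (blockLen c n) (labelBits c n) n).dur = gossipTime c n := by
  simp only [gossip, seq, dur_elect, dur_loop _ (fun _ => dur_move R (labelBits c n)), gossipTime]
  simp only [pure, round, broadcast]
  ring

theorem exec_gossip {A b B : ℕ} {S : ℕ → Set (ℕ × ℕ)} (hS : IsWakeupSchedule A (2 ^ b) B S)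
    [Fintype V] [Nontrivial V] {G : SimpleGraph V} (hG : G.Connected) {label : V → ℕ}
    (hinj : Function.Injective label) (hlab : ∀ x, label x < 2 ^ b) (hpos : ∀ x, 1 ≤ label x)
    (hB : B = 4 * A * Fintype.card V) (rumor : V → R) :
    (gossip R S B b (Fintype.card V)).exec G label rumor =
      fun _ => Set.range fun y => (label y, rumor y) := by
  classical
  have hlt : ∀ (C : Set V), ∀ l ∈ label '' C, l < 0 + 2 ^ b := by
    rintro C _ ⟨y, -, rfl⟩
    simpa using hlab y
  obtain ⟨v₀⟩ := hG.nonempty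
  obtain ⟨v, -, hv⟩ : searchMax (label '' {_y | True}) b 0 ∈ label '' {_y : V | True} :=
    searchMax_mem ⟨label v₀, ⟨v₀, trivial, rfl⟩, Nat.zero_le _⟩ (hlt _)
  have hround : ∀ x, (reception G label (fun y => if label y = label v then
      Action.transmit (Packet.empty R) else Action.receive) x).isSome = decide (G.Adj v x) := by
    intro x
    rw [reception_of_single label (v := v) (m := Packet.empty R) (by simp)
      (fun y hy => by simp [hinj.ne hy])]
    by_cases hx : G.Adj v x <;> simp [hx]
  -- The leader needs a neighbour as its first helper; this is why the network must have at least
  -- two nodes.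
  obtain ⟨w₀, hw₀⟩ := hG.preconnected.exists_adj_of_nontrivial v
  obtain ⟨w, hw, hwl⟩ : searchMax (label '' {y | decide (G.Adj v y) = true}) b 0 ∈
      label '' {y | decide (G.Adj v y) = true} :=
    searchMax_mem ⟨label w₀, ⟨w₀, by simpa using hw₀, rfl⟩, Nat.zero_le _⟩ (hlt _)
  simp only [Set.mem_ofPred_eq, decide_eq_true_eq] at hw
  rw [gossip, exec_seq, exec_pure, exec_seq, exec_elect hS hG hinj hlab hB _ _ _ rumor, ← hv,
    exec_seq, exec_round]
  simp only [hround]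
  rw [exec_seq, exec_elect hS hG hinj hlab hB _ _ _
    (fun x => ((rumor x, label v), decide (G.Adj v x))), ← hwl, exec_seq, exec_pure]
  set T : Token R := ⟨[], {(label v, rumor v)}, label w⟩ with hT
  have hstart : (fun x => ((rumor x, if label x = label v then
      some (Token.mk [] {(label x, rumor x)} (label w)) else none), 0)) =
      tokenAt rumor v T 0 := by
    funext x
    by_cases hx : x = v
    · subst hx; simp [tokenAt, hT]
    · simp [tokenAt, hx, hinj.ne hx]
  simp only [hstart]
  have hinv : TravInv G label rumor v T {v} [] := by
    refine ⟨rfl, by simp [hT], ⟨w, hw, rfl⟩, by simp, by simp, by simp, ?_⟩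
    intro y hy hyv
    exact absurd (Finset.mem_singleton.1 hy) hyv
  -- The initial potential is `2`, from one visited node and an empty stack, so `2 n` moves suffice.
  obtain ⟨v', T', hT', he⟩ := hinv.exec_loop_move hG hinj hlab hpos (2 * Fintype.card V) (by simp)
  rw [exec_seq, he, exec_broadcast hS hG hinj hlab hB _ _ _ ⟨0, 0, [], T'.known⟩]
  · rw [if_pos ⟨v', by simp [tokenAt]⟩]
    funext x
    simp [hT']
  · intro x k hk
    by_cases hx : x = v'
    · simpa [tokenAt, hx, eq_comm] using hk
    · simp [tokenAt, hx] at hk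

end Subroutine

open Classical in
/-- A wake-up schedule for networks of `n` nodes with labels up to `n ^ c`. -/
noncomputable def schedule (c n : ℕ) : ℕ → Set (ℕ × ℕ) :=
  if hn : 1 ≤ n then (exists_schedule c hn).choose else fun _ => ∅

theorem schedule_spec (c : ℕ) {n : ℕ} (hn : 1 ≤ n) :
    IsWakeupSchedule (stretch c n) (2 ^ labelBits c n) (blockLen c n) (schedule c n) := by
  rw [schedule, dif_pos hn]
  exact (exists_schedule c hn).choose_spec

/-- The gossiping protocol. -/
noncomputable def gossipProtocol (c : ℕ) (R : Type u) : Protocol R where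
  Msg := Packet R
  act n := (Subroutine.gossip R (schedule c n) (blockLen c n) (labelBits c n) n).act
  output n l r h := if n ≤ 1 then {(l, r)} else
    (Subroutine.gossip R (schedule c n) (blockLen c n) (labelBits c n) n).out l r h

theorem history_gossipProtocol (c : ℕ) (R : Type u) {V : Type v} [Fintype V] (G : SimpleGraph V)
    (label : V → ℕ) (rumor : V → R) (t : ℕ) (x : V) :
    (gossipProtocol c R).history G label rumor t x =
      (Subroutine.gossip R (schedule c (Fintype.card V)) (blockLen c (Fintype.card V))
        (labelBits c (Fintype.card V)) (Fintype.card V)).hist G label rumor t x := by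
  induction t generalizing x with
  | zero => rfl
  | succ t ih =>
    rw [Protocol.history, Subroutine.hist, ih]
    simp only [ih]
    rfl

theorem gossipProtocol_completesGossiping (c : ℕ) (R : Type u) {V : Type v} [Fintype V]
    (G : SimpleGraph V) (label : V → ℕ) (hG : G.Connected) (hinj : Function.Injective label)
    (hlab : ∀ x : V, label x ∈ Set.Icc 1 (Fintype.card V ^ c)) :
    (gossipProtocol c R).CompletesGossiping G label (gossipTime c (Fintype.card V)) := by
  intro rumor x
  have hn : 1 ≤ Fintype.card V := Fintype.card_pos_iff.2 hG.nonempty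
  -- A single node has no helper, so the protocol outputs its own pair directly.
  rcases hn.eq_or_lt with h1 | h1
  · have hs : Subsingleton V := Fintype.card_le_one_iff_subsingleton.1 h1.ge
    have e : (gossipProtocol c R).output (Fintype.card V) (label x) (rumor x)
        ((gossipProtocol c R).history G label rumor (gossipTime c (Fintype.card V)) x) =
        {(label x, rumor x)} := if_pos h1.ge
    rw [e]
    ext q
    simp only [Set.mem_singleton_iff, Set.mem_range]
    constructor
    · rintro rfl; exact ⟨x, rfl⟩
    · rintro ⟨y, rfl⟩; rw [Subsingleton.elim y x]
  · have : Nontrivial V := Fintype.one_lt_card_iff_nontrivial.1 h1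
    have hex := Subroutine.exec_gossip (schedule_spec c hn) hG hinj
      (fun y => (hlab y).2.trans_lt (pow_lt_two_pow_labelBits c _)) (fun y => (hlab y).1) rfl rumor
    have hout : ∀ h, (gossipProtocol c R).output (Fintype.card V) (label x) (rumor x) h =
        (Subroutine.gossip R (schedule c (Fintype.card V)) (blockLen c (Fintype.card V))
          (labelBits c (Fintype.card V)) (Fintype.card V)).out (label x) (rumor x) h :=
      fun h => if_neg (by omega)
    rw [hout, history_gossipProtocol,
      ← Subroutine.dur_gossip R (schedule c (Fintype.card V)) c (Fintype.card V)]
    exact congrFun hex x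

end RadioNetwork

theorem mainTheorem1 (c : ℕ) :
    ∃ T : ℕ → ℕ,
      ((fun n : ℕ => (T n : ℝ)) =O[atTop]
        fun n : ℕ => (n : ℝ) * Real.logb 2 n ^ 2 * Real.logb 2 (Real.logb 2 n)) ∧
      ∀ R : Type u, ∃ π : RadioNetwork.Protocol R,
        ∀ (V : Type v) [Fintype V] (G : SimpleGraph V) (label : V → ℕ),
          G.Connected → Function.Injective label →
          (∀ x : V, label x ∈ Set.Icc 1 (Fintype.card V ^ c)) →
          π.CompletesGossiping G label (T (Fintype.card V)) :=
  ⟨RadioNetwork.gossipTime c, RadioNetwork.gossipTime_isBigO c, fun R =>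
    ⟨RadioNetwork.gossipProtocol c R, fun _ _ G label hG hinj hlab =>
      RadioNetwork.gossipProtocol_completesGossiping c R G label hG hinj hlab⟩⟩
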